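/- \textbf{Definitions.} A function $f:\{0,1\}^\star\to\mathbb{R}$ is a \emph{weighted counting problem in} $\#\mathrm{P}_{\mathbb{R}}$ if there are a polynomial $p$ and a weight function $w:\{0,1\}^\star\times\{0,1\}^\star\to\mathbb{R}$ with \[ f(x)=\sum_{u\in\{0,1\}^{p(|x|)}} w(x,u)\qquad (x\in\{0,1\}^\star), \] where $w$ can be approximated by a function $v:\{0,1\}^\star\times\{0,1\}^\star\times\mathbb{N}\to\mathbb{Z}$ such that $v(x,u,b)$ is computable by a Turing machine in time polynomial in $|x|$, $|u|$ and $b$, and $|w(x,u)-v(x,u,b)/2^b|\le 2^{-b}$ for all $x,u,b$. The class $\#\mathrm{P}$ consists of the functions $g(x)=\sum_{u\in\{0,1\}^{p(|x|)}}T(x,u)$, with $p$ a polynomial and $T$ a polynomial-time predicate with values in $\{0,1\}$. The class $\mathrm{FP}^{\#\mathrm{P}[1]}$ consists of the functions that are computed by a polynomial-time deterministic oracle Turing machine which, on every input, makes at most one call to an oracle for a function in $\#\mathrm{P}$ (the answer being written in binary). Rational numbers are encoded as fractions in lowest terms, with a sign and with numerator and denominator in binary. \textbf{Theorem.} Let $f:\{0,1\}^\star\to\mathbb{R}$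 be a weighted counting problem in $\#\mathrm{P}_{\mathbb{R}}$, and let $q$ be a polynomial such that for every $x\in\{0,1\}^\star$ the value $f(x)$ is a rational number whose encoding as a fraction has length at most $q(|x|)$. Then $f$, regarded as the function that maps $x$ to the fraction $f(x)$, is in $\mathrm{FP}^{\#\mathrm{P}[1]}$. -/

import Mathlib

namespace WeightedCounting

/-! ### Encodings over finite alphabets

Bit strings are `List Bool`.  The symbol `none` of the alphabet `Option Bool` is a separator. -/

/-- Encoding of a pair `(x, u)` of bit strings; its length is `|x| + |u| + 1`. -/
def encodePair (a : List Bool × List Bool) : List (Option Bool) :=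
  a.1.map some ++ none :: a.2.map some

/-- Encoding of `(x, u, b)` with `b` in unary; its length is `|x| + |u| + b + 2`, so that a running
time polynomial in this length is polynomial in the sizes of `x` and `u` and in the number `b`. -/
def encodeTriple (a : List Bool × List Bool × ℕ) : List (Option Bool) :=
  a.1.map some ++ none :: (a.2.1.map some ++ none :: List.replicate a.2.2 (some true))

/-- Binary encoding of an integer: a sign bit, followed by the binary digits of the absolute
value, least significant digit first. -/
def encodeInt (z : ℤ) : List Bool :=
  decide (z < 0) :: z.natAbs.bits

/-- Encoding of a rational number as a fraction in lowest terms: numerator, separator,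
denominator, both in binary. -/
def encodeRat (r : ℚ) : List (Option Bool) :=
  (encodeInt r.num).map some ++ none :: r.den.bits.map some

/-! ### Polynomial time -/

/-- `f` is computed by a polynomial-time Turing machine with respect to the encodings `ea`, `eb` of
its arguments and values. -/
def PolyTime {α β αΓ βΓ : Type} (ea : α → List αΓ) (eb : β → List βΓ) (f : α → β) : Prop :=
  Nonempty (Turing.TM2ComputableInPolyTime ea eb f)

/-! ### Counting problems -/

/-- The class `#P`: the functions `g x = ∑ u ∈ {0,1}^(p |x|), T (x, u)` for a polynomial `p` and a
polynomial-time predicate `T`. -/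
def SharpP : Set (List Bool → ℕ) :=
  {g | ∃ (p : Polynomial ℕ) (T : List Bool × List Bool → Bool),
    PolyTime encodePair Computability.encodeBool T ∧
    ∀ x, g x = ∑ u : Fin (p.eval x.length) → Bool, (T (x, List.ofFn u)).toNat}

/-- The weight function `w` is approximated by a function `v` with integer values such that
`v (x, u, b)` is computable in time polynomial in `|x|`, `|u|` and `b`. -/
def Approximable (w : List Bool → List Bool → ℝ) : Prop :=
  ∃ v : List Bool × List Bool × ℕ → ℤ,
    PolyTime encodeTriple encodeInt v ∧
    ∀ x u b, |w x u - (v (x, u, b) : ℝ) / 2 ^ b| ≤ 1 / 2 ^ b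

/-- The class `#P_S` of weighted counting problems with weights in `S`: the functions
`f x = ∑ u ∈ {0,1}^(p |x|), w x u` for a polynomial `p` and an approximable `w` with range
in `S`. -/
def SharpPWeighted (S : Set ℝ) : Set (List Bool → ℝ) :=
  {f | ∃ (p : Polynomial ℕ) (w : List Bool → List Bool → ℝ),
    Approximable w ∧ (∀ x u, w x u ∈ S) ∧
    ∀ x, f x = ∑ u : Fin (p.eval x.length) → Bool, w x (List.ofFn u)}

/-! ### Oracle machines -/

/-- A Turing machine (with input alphabet `Γ₀` and output alphabet `Γ₁`) with a query tape and an
answer tape over the binary alphabet, a query state and an answer state. -/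
structure OracleTM (Γ₀ Γ₁ : Type) extends Turing.TM2ComputableAux Γ₀ Γ₁ where
  /-- the query tape -/
  kq : tm.K
  /-- the answer tape -/
  ka : tm.K
  /-- the alphabet of the query tape is binary -/
  queryAlphabet : tm.Γ kq ≃ Bool
  /-- the alphabet of the answer tape is binary -/
  answerAlphabet : tm.Γ ka ≃ Bool
  /-- the query state -/
  queryLabel : tm.Λ
  /-- the state in which the machine resumes after an oracle call -/
  answerLabel : tm.Λ

namespace OracleTM

variable {Γ₀ Γ₁ : Type} (M : OracleTM Γ₀ Γ₁)

/-- The configuration after an oracle call: the query tape is erased, the answer tape holds the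
answer of the oracle to the former contents of the query tape, and the machine is in the answer
state. -/
def call (O : List Bool → List Bool) (c : M.tm.Cfg) : M.tm.Cfg where
  l := some M.answerLabel
  var := c.var
  stk := Function.update (Function.update c.stk M.kq []) M.ka
    ((O ((c.stk M.kq).map M.queryAlphabet)).map M.answerAlphabet.symm)

open Classical in
/-- One step of the machine with oracle `O`, on a configuration together with the number of oracle
calls made so far.  In the query state the oracle is called; in all other states the machine makes
one of its own steps. -/
noncomputable def step (O : List Bool → List Bool) (c : M.tm.Cfg × ℕ) : Option (M.tm.Cfg × ℕ) :=
  if c.1.l = some M.queryLabel then some (M.call O c.1, c.2 + 1)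
  else (M.tm.step c.1).map fun c' => (c', c.2)

/-- The machine with oracle `O` computes `f` in polynomial time, with at most `m` oracle calls on
every input. -/
def Computes {α β : Type} (O : List Bool → List Bool) (m : ℕ) (ea : α → List Γ₀) (eb : β → List Γ₁)
    (f : α → β) : Prop :=
  ∃ t : Polynomial ℕ, ∀ a, ∃ n ≤ m,
    Nonempty (StateTransition.EvalsToInTime (M.step O)
      (Turing.initList M.tm ((ea a).map M.inputAlphabet.symm), 0)
      (some (Turing.haltList M.tm ((eb (f a)).map M.outputAlphabet.symm), n))
      (t.eval (ea a).length))

end OracleTM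

/-- The class `FP^{#P[m]}`: the functions on bit strings (with values encoded by `eb`) that are
computed in polynomial time with at most `m` calls to an oracle for a function in `#P`, whose
answers are written in binary, least significant digit first. -/
def FPSharpP (m : ℕ) {β βΓ : Type} (eb : β → List βΓ) : Set (List Bool → β) :=
  {f | ∃ g ∈ SharpP, ∃ M : OracleTM Bool βΓ,
    M.Computes (fun y => (g y).bits) m (fun x : List Bool => x) eb f}

end WeightedCounting

/-! Fix `x` and put `b = B(|x|)` with `B = p + 2q + 2`. Replacing every weight by `v(x,u,b) / 2^b`
changes the sum by at most `2^p / 2^b`, so the integer `∑ v(x,u,b)` determines `f(x)` up to an error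
of `1 / (4 · 2^(2q))`. A fraction with denominator below `2^q` is determined by such an
approximation and can be recovered from it by continued fractions. It remains to obtain the integer
from a single `#P` query.

The query (`sharpP_shift`). Since `v` is computable in polynomial time, `|v(x,u,b)| < 2^s` for a
polynomial `s`. The numbers `v + 2^s` are then nonnegative, and each of them counts the strings `t`
of length `s + 1` whose value is below it. Their sum over `u` is the number `g(x)` of accepted pairs
`(u,t)`. With `s = d + B` the shift contributes the integer `2^(p+d)` to `g(x) / 2^B`; adding an
integer to a fraction in lowest terms keeps the denominator, and the shift is undone after
reconstruction.

The reconstruction (`search_eq`). By Legendre's theorem the wanted fraction is a convergent of `g(x)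
/ 2^B`, and the extended Euclidean algorithm lists the convergents in polynomially many steps.
Conversely, a convergent with small denominator that is as close to `g(x) / 2^B` as required must be
the wanted fraction, because distinct fractions with denominators below `Q` differ by more than `1 /
Q^2`. Hence any convergent that passes the test is correct.

The machines. Polynomial time is established through a small structured language of stack programs,
with one instruction that calls a fixed machine `M`. `Exec.runs` shows that compiled code simulates
a program with the same number of steps, inside ordinary and oracle machines alike. The predicate
`PT M` (polynomial-time programs with subroutine `M`) is closed under composition, pairing, case
distinction and bounded recursion, and from these come the arithmetic operations, including
division, and the search. `PT.of_polyTime` imports the machine for `v` as a subroutine,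
`PT.polyTime` exports predicates as machines, and `PT.fpSharpP` builds the machine with one oracle
call. -/

namespace WeightedCounting

open Turing Function

/-! ### A structured language for stack machines -/

/-- The working stacks. -/
inductive Stk
  | A | B | C | Q | R
  deriving DecidableEq

instance : Fintype Stk := ⟨{.A, .B, .C, .Q, .R}, fun k => by cases k <;> simp⟩

/-- The alphabets of the working stacks. -/
abbrev Stk.Sym : Stk → Type
  | .A | .B | .C => Option Bool
  | .Q | .R => Bool

/-- The stacks of a program with subroutine `M`. -/
abbrev Idx (M : FinTM2) : Type := Stk ⊕ M.K

/-- The stack alphabets of a program with subroutine `M`. -/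
abbrev Sym (M : FinTM2) : Idx M → Type
  | .inl k => k.Sym
  | .inr k => M.Γ k

/-- The contents of the stacks. -/
abbrev Store (M : FinTM2) : Type := ∀ k : Idx M, List (Sym M k)

/-- The internal states of a compiled program. -/
abbrev Var (M : FinTM2) : Type := M.σ × Option Bool

/-- Structured programs on the stacks `Idx M`. -/
inductive Prog (M : FinTM2) : Type
  | push (k : Idx M) (a : Sym M k) : Prog M
  | seq (p q : Prog M) : Prog M
  | case (k : Idx M) (φ : Sym M k → Option Bool) (pt pf pn : Prog M) : Prog M
  | loop (k : Idx M) (φ : Sym M k → Option Bool) (pt pf : Prog M) : Prog M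
  | call : Prog M

/-- `Runs st n c c'` : from `c`, `n` steps of `st` lead to `c'`. -/
def Runs {X : Type} (st : X → Option X) (n : ℕ) (c c' : X) : Prop :=
  (flip bind st)^[n] (some c) = some c'

theorem Runs.refl {X : Type} (st : X → Option X) (c : X) : Runs st 0 c c := rfl

theorem Runs.head {X : Type} {st : X → Option X} {n : ℕ} {c c' c'' : X} (h : st c = some c')
    (h' : Runs st n c' c'') : Runs st (n + 1) c c'' := by
  unfold Runs
  rw [iterate_succ_apply]
  change (flip bind st)^[n] (st c) = _
  rw [h]
  exact h'

theorem Runs.single {X : Type} {st : X → Option X} {c c' : X} (h : st c = some c') :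
    Runs st 1 c c' :=
  Runs.head h (Runs.refl _ _)

theorem Runs.trans {X : Type} {st : X → Option X} {m n : ℕ} {c c' c'' : X} (h : Runs st m c c')
    (h' : Runs st n c' c'') : Runs st (m + n) c c'' := by
  unfold Runs at *
  rw [add_comm, iterate_add_apply, h, h']

theorem iterate_bind_none {X : Type} (st : X → Option X) (n : ℕ) :
    (flip bind st)^[n] none = none := by
  induction n with
  | zero => rfl
  | succ n ih => rw [iterate_succ_apply]; exact ih

theorem Runs.cases_succ {X : Type} {st : X → Option X} {n : ℕ} {c c'' : X}
    (h : Runs st (n + 1) c c'') : ∃ c', st c = some c' ∧ Runs st n c' c'' := by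
  unfold Runs at h
  rw [iterate_succ_apply] at h
  change (flip bind st)^[n] (st c) = _ at h
  cases hc : st c with
  | none => rw [hc, iterate_bind_none] at h; cases h
  | some c' => exact ⟨c', rfl, by rwa [hc] at h⟩

variable {M : FinTM2}

/-- The store with the given contents of the working stacks and of the stacks of `M`. -/
def mk (a b c : List (Option Bool)) (q r : List Bool) (m : ∀ k, List (M.Γ k)) : Store M
  | .inl .A => a
  | .inl .B => b
  | .inl .C => c
  | .inl .Q => q
  | .inl .R => r
  | .inr k => m k

/-- Replace the contents of the stacks of `M`. -/
def setSub (S : Store M) (m : ∀ k, List (M.Γ k)) : Store M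
  | .inl k => S (.inl k)
  | .inr k => m k

/-- Big-step semantics with running times. -/
inductive Exec : Prog M → Store M → Store M → ℕ → Prop
  | push (k : Idx M) (a : Sym M k) (S : Store M) : Exec (.push k a) S (update S k (a :: S k)) 1
  | seq {p q : Prog M} {S S' S'' : Store M} {t t' : ℕ} (hp : Exec p S S' t)
      (hq : Exec q S' S'' t') : Exec (.seq p q) S S'' (t + t')
  | case_none {k : Idx M} {φ : Sym M k → Option Bool} {pt pf pn : Prog M} {S S' : Store M} {t : ℕ}
      (h : (S k).head?.bind φ = none) (hp : Exec pn (update S k (S k).tail) S' t) :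
      Exec (.case k φ pt pf pn) S S' (t + 1)
  | case_some {k : Idx M} {φ : Sym M k → Option Bool} {pt pf pn : Prog M} {S S' : Store M} {t : ℕ}
      (b : Bool) (h : (S k).head?.bind φ = some b)
      (hp : Exec (cond b pt pf) (update S k (S k).tail) S' t) :
      Exec (.case k φ pt pf pn) S S' (t + 1)
  | loop_none {k : Idx M} {φ : Sym M k → Option Bool} {pt pf : Prog M} {S : Store M}
      (h : (S k).head?.bind φ = none) : Exec (.loop k φ pt pf) S (update S k (S k).tail) 1
  | loop_some {k : Idx M} {φ : Sym M k → Option Bool} {pt pf : Prog M} {S S' S'' : Store M}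
      {t t' : ℕ} (b : Bool) (h : (S k).head?.bind φ = some b)
      (hp : Exec (cond b pt pf) (update S k (S k).tail) S' t)
      (hl : Exec (.loop k φ pt pf) S' S'' t') : Exec (.loop k φ pt pf) S S'' (t + t' + 1)
  | call {s : List (M.Γ M.k₀)} {s' : List (M.Γ M.k₁)} {t : ℕ} (S : Store M)
      (h : Runs M.step t (initList M s) (haltList M s')) :
      Exec .call (setSub S (initList M s).stk) (setSub S (haltList M s').stk) t

/-! ### Compilation to stack machines -/

/-- The labels of a compiled program. -/
def Lab : Prog M → Type
  | .push _ _ => Unit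
  | .seq p q => Lab p ⊕ Lab q
  | .case _ _ pt pf pn => Option (Lab pt ⊕ Lab pf ⊕ Lab pn)
  | .loop _ _ pt pf => Option (Lab pt ⊕ Lab pf)
  | .call => M.Λ

/-- There are finitely many labels. -/
@[reducible] def labFintype : (p : Prog M) → Fintype (Lab p)
  | .push _ _ => inferInstanceAs (Fintype Unit)
  | .seq p q =>
    letI := labFintype p; letI := labFintype q; inferInstanceAs (Fintype (Lab p ⊕ Lab q))
  | .case _ _ pt pf pn =>
    letI := labFintype pt; letI := labFintype pf; letI := labFintype pn
    inferInstanceAs (Fintype (Option (Lab pt ⊕ Lab pf ⊕ Lab pn)))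
  | .loop _ _ pt pf =>
    letI := labFintype pt; letI := labFintype pf
    inferInstanceAs (Fintype (Option (Lab pt ⊕ Lab pf)))
  | .call => M.ΛFin

instance (p : Prog M) : Fintype (Lab p) := labFintype p

/-- The label at which a compiled program starts. -/
def entry : (p : Prog M) → Lab p
  | .push _ _ => ()
  | .seq p _ => Sum.inl (entry p)
  | .case _ _ _ _ _ => (none : Option _)
  | .loop _ _ _ _ => (none : Option _)
  | .call => M.main

/-- The statements of the subroutine `M` as statements of the compiled program. -/
def liftStmt {Λ : Type} (em : M.Λ → Λ) (ex : Λ) :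
    TM2.Stmt M.Γ M.Λ M.σ → TM2.Stmt (Sym M) Λ (Var M)
  | .push k f q => .push (.inr k) (fun v => f v.1) (liftStmt em ex q)
  | .peek k f q => .peek (.inr k) (fun v o => (f v.1 o, v.2)) (liftStmt em ex q)
  | .pop k f q => .pop (.inr k) (fun v o => (f v.1 o, v.2)) (liftStmt em ex q)
  | .load f q => .load (fun v => (f v.1, v.2)) (liftStmt em ex q)
  | .branch f q₁ q₂ => .branch (fun v => f v.1) (liftStmt em ex q₁) (liftStmt em ex q₂)
  | .goto f => .goto fun v => em (f v.1)
  | .halt => .goto fun _ => ex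

/-- Three-way choice. -/
def choose {X : Type} (o : Option Bool) (xt xf xn : X) : X := o.elim xn fun b => cond b xt xf

/-- The code of a compiled program with labels embedded by `em` and exit label `ex`. -/
def code {Λ : Type} : (p : Prog M) → (Lab p → Λ) → Λ → Lab p → TM2.Stmt (Sym M) Λ (Var M)
  | .push k a, _, ex, _ => .push k (fun _ => a) (.goto fun _ => ex)
  | .seq p q, em, ex, l =>
    Sum.elim (code p (em ∘ Sum.inl) (em (Sum.inr (entry q)))) (code q (em ∘ Sum.inr) ex) l
  | .case k φ pt pf pn, em, ex, l =>
    Option.elim l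
      (.pop k (fun v o => (v.1, o.bind φ)) (.goto fun v => choose v.2
        (em (some (.inl (entry pt)))) (em (some (.inr (.inl (entry pf)))))
        (em (some (.inr (.inr (entry pn)))))))
      (Sum.elim (code pt (fun l => em (some (.inl l))) ex)
        (Sum.elim (code pf (fun l => em (some (.inr (.inl l)))) ex)
          (code pn (fun l => em (some (.inr (.inr l)))) ex)))
  | .loop k φ pt pf, em, ex, l =>
    Option.elim l
      (.pop k (fun v o => (v.1, o.bind φ)) (.goto fun v => choose v.2
        (em (some (.inl (entry pt)))) (em (some (.inr (entry pf)))) ex))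
      (Sum.elim (code pt (fun l => em (some (.inl l))) (em (none : Option _)))
        (code pf (fun l => em (some (.inr l))) (em (none : Option _))))
  | .call, em, ex, l => liftStmt em ex (M.m l)

theorem update_setSub (S : Store M) (m : ∀ k, List (M.Γ k)) (k : M.K) (l : List (M.Γ k)) :
    update (setSub S m) (.inr k) l = setSub S (update m k l) := by
  funext j
  rcases j with j | j
  · rw [update_of_ne (by simp)]; rfl
  · by_cases h : j = k
    · subst h; simp [setSub]
    · rw [update_of_ne (by simpa using h)]; simp [setSub, h]

/-- The configuration of the compiled program that corresponds to one of the subroutine. -/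
def embCfg {Λ : Type} (em : M.Λ → Λ) (ex : Λ) (w : Option Bool) (S : Store M)
    (c : TM2.Cfg M.Γ M.Λ M.σ) : TM2.Cfg (Sym M) Λ (Var M) :=
  ⟨some (c.l.elim ex em), (c.var, w), setSub S c.stk⟩

/-- Halting of the subroutine becomes a jump to `ex`, which is why `embCfg` gives a halted
configuration the label `ex`. The lifted statements touch neither the outer register `w` nor the
working stacks. -/
theorem stepAux_liftStmt {Λ : Type} (em : M.Λ → Λ) (ex : Λ) (w : Option Bool) (S : Store M)
    (q : TM2.Stmt M.Γ M.Λ M.σ) (v : M.σ) (m : ∀ k, List (M.Γ k)) :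
    TM2.stepAux (liftStmt em ex q) (v, w) (setSub S m) =
      embCfg em ex w S (TM2.stepAux q v m) := by
  induction q generalizing v m with
  | push k f q ih => rw [liftStmt, TM2.stepAux, TM2.stepAux, update_setSub]; exact ih _ _
  | peek k f q ih => rw [liftStmt, TM2.stepAux, TM2.stepAux]; exact ih _ _
  | pop k f q ih => rw [liftStmt, TM2.stepAux, TM2.stepAux, update_setSub]; exact ih _ _
  | load f q ih => rw [liftStmt, TM2.stepAux, TM2.stepAux]; exact ih _ _
  | branch f q₁ q₂ ih₁ ih₂ =>
    rw [liftStmt, TM2.stepAux, TM2.stepAux]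
    cases f v
    · exact ih₂ _ _
    · exact ih₁ _ _
  | goto f => rfl
  | halt => rfl

theorem runs_liftStmt {X Λ : Type} {st : X → Option X} {ι : TM2.Cfg (Sym M) Λ (Var M) → X}
    {em : M.Λ → Λ} {ex : Λ}
    (H : ∀ l v S, st (ι ⟨some (em l), v, S⟩) = some (ι (TM2.stepAux (liftStmt em ex (M.m l)) v S)))
    (w : Option Bool) (S : Store M) {n : ℕ} {c c' : M.Cfg} (h : Runs M.step n c c') :
    Runs st n (ι (embCfg em ex w S c)) (ι (embCfg em ex w S c')) := by
  induction n generalizing c with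
  | zero => cases h; exact Runs.refl _ _
  | succ n ih =>
    obtain ⟨c₁, h₁, h₂⟩ := h.cases_succ
    refine Runs.head ?_ (ih h₂)
    obtain ⟨l, v, m⟩ := c
    cases l with
    | none => cases h₁
    | some l =>
      cases h₁
      refine (H l (v, w) (setSub S m)).trans ?_
      rw [stepAux_liftStmt]

/-- A machine that contains the code of a program executes the program. -/
theorem Exec.runs {X Λ : Type} {st : X → Option X} {ι : TM2.Cfg (Sym M) Λ (Var M) → X}
    {p : Prog M} {S S' : Store M} {t : ℕ} (h : Exec p S S' t) {em : Lab p → Λ} {ex : Λ}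
    (H : ∀ l v S, st (ι ⟨some (em l), v, S⟩) = some (ι (TM2.stepAux (code p em ex l) v S)))
    (w : Option Bool) :
    ∃ w', Runs st t (ι ⟨some (em (entry p)), (M.initialState, w), S⟩)
      (ι ⟨some ex, (M.initialState, w'), S'⟩) := by
  -- The hypothesis `H` only asks that `st` acts as the compiled code on the labels of `p`. With `X`
  -- and `ι` arbitrary, the same induction serves machines whose configurations carry an oracle-call
  -- counter. The register `w` holds the outcome of the last test and is never read before being
  -- overwritten, so its final value is left unspecified.
  induction h generalizing ex w with
  | push k a S => exact ⟨w, Runs.single (H _ _ _)⟩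
  | seq _ _ ih₁ ih₂ =>
    obtain ⟨w₁, h₁⟩ := ih₁ (fun l v S => H (Sum.inl l) v S) w
    obtain ⟨w₂, h₂⟩ := ih₂ (fun l v S => H (Sum.inr l) v S) w₁
    exact ⟨w₂, h₁.trans h₂⟩
  | @case_none k φ pt pf pn S S' t hb _ ih =>
    obtain ⟨w₁, h₁⟩ := ih (fun l v S => H (some (.inr (.inr l))) v S) none
    refine ⟨w₁, Runs.head ((H (none : Option _) _ _).trans ?_) h₁⟩
    simp [code, choose, hb]
  | @case_some k φ pt pf pn S S' t b hb _ ih =>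
    cases b
    · obtain ⟨w₁, h₁⟩ := ih (fun l v S => H (some (.inr (.inl l))) v S) (some false)
      refine ⟨w₁, Runs.head ((H (none : Option _) _ _).trans ?_) h₁⟩
      simp [code, choose, hb]
    · obtain ⟨w₁, h₁⟩ := ih (fun l v S => H (some (.inl l)) v S) (some true)
      refine ⟨w₁, Runs.head ((H (none : Option _) _ _).trans ?_) h₁⟩
      simp [code, choose, hb]
  | @loop_none k φ pt pf S hb =>
    refine ⟨none, Runs.single ((H (none : Option _) _ _).trans ?_)⟩
    simp [code, choose, hb]
  | @loop_some k φ pt pf S S' S'' t t' b hb _ _ ih₁ ih₂ =>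
    cases b
    · obtain ⟨w₁, h₁⟩ := ih₁ (fun l v S => H (some (.inr l)) v S) (some false)
      obtain ⟨w₂, h₂⟩ := ih₂ H w₁
      refine ⟨w₂, Runs.head ((H (none : Option _) _ _).trans ?_) (h₁.trans h₂)⟩
      simp [code, choose, hb]
    · obtain ⟨w₁, h₁⟩ := ih₁ (fun l v S => H (some (.inl l)) v S) (some true)
      obtain ⟨w₂, h₂⟩ := ih₂ H w₁
      refine ⟨w₂, Runs.head ((H (none : Option _) _ _).trans ?_) (h₁.trans h₂)⟩
      simp [code, choose, hb]
  -- Both `initList` and `haltList` carry `M.initialState`, so the subroutine's internal state is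
  -- the same before and after the call.
  | call S h => exact ⟨w, runs_liftStmt H w S h⟩

/-! ### Symbolic execution -/

section mk

variable (a b c : List (Option Bool)) (q r : List Bool) (m : ∀ k, List (M.Γ k))

@[simp] theorem mk_A : mk a b c q r m (.inl .A) = a := rfl
@[simp] theorem mk_B : mk a b c q r m (.inl .B) = b := rfl
@[simp] theorem mk_C : mk a b c q r m (.inl .C) = c := rfl
@[simp] theorem mk_Q : mk a b c q r m (.inl .Q) = q := rfl
@[simp] theorem mk_R : mk a b c q r m (.inl .R) = r := rfl
@[simp] theorem mk_inr (k : M.K) : mk a b c q r m (.inr k) = m k := rfl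

@[simp] theorem update_mk_A (l : List (Option Bool)) :
    update (mk a b c q r m) (.inl .A) l = mk l b c q r m := by
  funext k; rcases k with (_ | _ | _ | _ | _) | k <;> simp [update_of_ne]

@[simp] theorem update_mk_B (l : List (Option Bool)) :
    update (mk a b c q r m) (.inl .B) l = mk a l c q r m := by
  funext k; rcases k with (_ | _ | _ | _ | _) | k <;> simp [update_of_ne]

@[simp] theorem update_mk_C (l : List (Option Bool)) :
    update (mk a b c q r m) (.inl .C) l = mk a b l q r m := by
  funext k; rcases k with (_ | _ | _ | _ | _) | k <;> simp [update_of_ne]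

@[simp] theorem update_mk_Q (l : List Bool) :
    update (mk a b c q r m) (.inl .Q) l = mk a b c l r m := by
  funext k; rcases k with (_ | _ | _ | _ | _) | k <;> simp [update_of_ne]

@[simp] theorem update_mk_R (l : List Bool) :
    update (mk a b c q r m) (.inl .R) l = mk a b c q l m := by
  funext k; rcases k with (_ | _ | _ | _ | _) | k <;> simp [update_of_ne]

@[simp] theorem update_mk_inr (k : M.K) (l : List (M.Γ k)) :
    update (mk a b c q r m) (.inr k) l = mk a b c q r (update m k l) := by
  funext j
  rcases j with (_ | _ | _ | _ | _) | j
  iterate 5 simp [update_of_ne]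
  by_cases h : j = k
  · subst h; simp
  · rw [update_of_ne (by simpa using h)]; simp [h]

theorem setSub_mk (m' : ∀ k, List (M.Γ k)) : setSub (mk a b c q r m) m' = mk a b c q r m' := by
  funext k; rcases k with (_ | _ | _ | _ | _) | k <;> rfl

end mk

end WeightedCounting

namespace WeightedCounting

open Turing Function

variable {M : FinTM2}

/-! ### Programs with time bounds -/

/-- `p` leads from `S` to `S'` in at most `T` steps. -/
def ExecLE (p : Prog M) (S S' : Store M) (T : ℕ) : Prop := ∃ t ≤ T, Exec p S S' t

theorem ExecLE.mono {p : Prog M} {S S' : Store M} {T T' : ℕ} (h : ExecLE p S S' T) (hT : T ≤ T') :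
    ExecLE p S S' T' := by
  obtain ⟨t, ht, h⟩ := h
  exact ⟨t, ht.trans hT, h⟩

theorem ExecLE.congr {p : Prog M} {S S' S₁ S₁' : Store M} {T T' : ℕ} (h : ExecLE p S S' T)
    (hS : S = S₁) (hS' : S' = S₁') (hT : T ≤ T') : ExecLE p S₁ S₁' T' := by
  subst hS hS'
  exact h.mono hT

theorem ExecLE.seq {p q : Prog M} {S S' S'' : Store M} {T T' : ℕ} (hp : ExecLE p S S' T)
    (hq : ExecLE q S' S'' T') : ExecLE (.seq p q) S S'' (T + T') := by
  obtain ⟨t, ht, hp⟩ := hp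
  obtain ⟨t', ht', hq⟩ := hq
  exact ⟨t + t', Nat.add_le_add ht ht', hp.seq hq⟩

theorem ExecLE.push (k : Idx M) (a : Sym M k) (S : Store M) :
    ExecLE (.push k a) S (update S k (a :: S k)) 1 := ⟨1, le_rfl, .push k a S⟩

theorem ExecLE.case_none {k : Idx M} {φ : Sym M k → Option Bool} {pt pf pn : Prog M}
    {S S' : Store M} {T : ℕ} (h : (S k).head?.bind φ = none)
    (hp : ExecLE pn (update S k (S k).tail) S' T) : ExecLE (.case k φ pt pf pn) S S' (T + 1) := by
  obtain ⟨t, ht, hp⟩ := hp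
  exact ⟨t + 1, Nat.add_le_add_right ht 1, .case_none h hp⟩

theorem ExecLE.case_some {k : Idx M} {φ : Sym M k → Option Bool} {pt pf pn : Prog M}
    {S S' : Store M} {T : ℕ} (b : Bool) (h : (S k).head?.bind φ = some b)
    (hp : ExecLE (cond b pt pf) (update S k (S k).tail) S' T) :
    ExecLE (.case k φ pt pf pn) S S' (T + 1) := by
  obtain ⟨t, ht, hp⟩ := hp
  exact ⟨t + 1, Nat.add_le_add_right ht 1, .case_some b h hp⟩

theorem ExecLE.loop_none {k : Idx M} {φ : Sym M k → Option Bool} {pt pf : Prog M} {S : Store M}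
    (h : (S k).head?.bind φ = none) : ExecLE (.loop k φ pt pf) S (update S k (S k).tail) 1 :=
  ⟨1, le_rfl, .loop_none h⟩

theorem ExecLE.loop_some {k : Idx M} {φ : Sym M k → Option Bool} {pt pf : Prog M}
    {S S' S'' : Store M} {T T' : ℕ} (b : Bool) (h : (S k).head?.bind φ = some b)
    (hp : ExecLE (cond b pt pf) (update S k (S k).tail) S' T)
    (hl : ExecLE (.loop k φ pt pf) S' S'' T') : ExecLE (.loop k φ pt pf) S S'' (T + T' + 1) := by
  obtain ⟨t, ht, hp⟩ := hp
  obtain ⟨t', ht', hl⟩ := hl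
  exact ⟨t + t' + 1, by omega, .loop_some b h hp hl⟩

/-- Discard the top symbol of the stack `A`. -/
def popA : Prog M := .loop (.inl .A) (fun _ => none) .call .call

theorem execLE_popA (o : Option Bool) (a b c : List (Option Bool)) (q r : List Bool)
    (m : ∀ k, List (M.Γ k)) : ExecLE popA (mk (o :: a) b c q r m) (mk a b c q r m) 1 := by
  -- The test always fails, so the loop pops one symbol and ends; its bodies are never run.
  exact (ExecLE.loop_none (k := .inl .A) (φ := fun _ => none) (pt := .call) (pf := .call)
    (S := mk (o :: a) b c q r m) rfl).congr rfl (by simp) le_rfl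

/-- Do nothing. -/
def skip : Prog M := .seq (.push (.inl .A) none) popA

theorem execLE_skip (a b c : List (Option Bool)) (q r : List Bool) (m : ∀ k, List (M.Γ k)) :
    ExecLE skip (mk a b c q r m) (mk a b c q r m) 2 := by
  have h := ExecLE.push (.inl .A) none (mk a b c q r m)
  simp only [update_mk_A, mk_A] at h
  exact h.seq (execLE_popA _ _ _ _ _ _ _)

/-- Move bits from one stack to another. -/
def transfer (k : Idx M) (φ : Sym M k → Option Bool) (k' : Idx M) (ψ : Bool → Sym M k') : Prog M :=
  .loop k φ (.push k' (ψ true)) (.push k' (ψ false))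

/-- A loop pops the symbol on which its test fails, so the end marker is consumed and `r.tail`
remains. Moving symbols one at a time reverses their order. -/
theorem execLE_transfer {k k' : Idx M} (hk : k ≠ k') {φ : Sym M k → Option Bool}
    {e : Bool → Sym M k} (he : ∀ b, φ (e b) = some b) (ψ : Bool → Sym M k') (l : List Bool)
    {r : List (Sym M k)} (hr : r.head?.bind φ = none) (S : Store M) (hS : S k = l.map e ++ r) :
    ExecLE (transfer k φ k' ψ) S (update (update S k r.tail) k' (l.reverse.map ψ ++ S k'))
      (2 * l.length + 1) := by
  induction l generalizing S with
  | nil =>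
    simp only [List.map_nil, List.nil_append] at hS
    have := ExecLE.loop_none (k := k) (φ := φ) (pt := .push k' (ψ true)) (pf := .push k' (ψ false))
      (S := S) (by rw [hS]; exact hr)
    refine this.congr rfl ?_ (by simp)
    rw [hS]
    simp [update_of_ne hk.symm]
  | cons b l ih =>
    have h1 : (S k).tail = l.map e ++ r := by rw [hS]; rfl
    have h2 : ExecLE (cond b (.push k' (ψ true)) (.push k' (ψ false))) (update S k (S k).tail)
        (update (update S k (S k).tail) k' (ψ b :: S k')) 1 := by
      have := ExecLE.push k' (ψ b) (update S k (S k).tail)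
      rw [update_of_ne hk.symm] at this
      cases b <;> exact this
    have h3 := ih (update (update S k (S k).tail) k' (ψ b :: S k'))
      (by rw [update_of_ne hk, update_self, h1])
    refine (ExecLE.loop_some b (by rw [hS]; simp [he]) h2 h3).congr rfl ?_ (by simp; omega)
    rw [update_self, update_comm hk.symm, update_idem, update_idem]
    simp

/-! ### Items -/

/-- A bit string with an end marker. -/
def item (l : List Bool) : List (Option Bool) := l.map some ++ [none]

/-- A sequence of bit strings with end markers. -/
def encItems (L : List (List Bool)) : List (Option Bool) := L.flatMap item

/-- Reversal of a sequence of bit strings and of its members. -/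
def rv (L : List (List Bool)) : List (List Bool) := (L.map List.reverse).reverse

@[simp] theorem rv_rv (L : List (List Bool)) : rv (rv L) = L := by
  simp [rv, List.map_reverse]

@[simp] theorem length_rv (L : List (List Bool)) : (rv L).length = L.length := by simp [rv]

@[simp] theorem length_item (l : List Bool) : (item l).length = l.length + 1 := by simp [item]

@[simp] theorem encItems_nil : encItems [] = [] := rfl

theorem encItems_cons (l : List Bool) (L : List (List Bool)) :
    encItems (l :: L) = item l ++ encItems L := rfl

theorem encItems_append (L L' : List (List Bool)) :
    encItems (L ++ L') = encItems L ++ encItems L' := by simp [encItems]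

@[simp] theorem length_encItems_rv (L : List (List Bool)) :
    (encItems (rv L)).length = (encItems L).length := by
  induction L with
  | nil => rfl
  | cons l L ih =>
    have : rv (l :: L) = rv L ++ [l.reverse] := by simp [rv]
    rw [this, encItems_append, List.length_append, ih, encItems_cons, List.length_append]
    simp [encItems_cons, add_comm]

/-- Repetition of a program. -/
def rep : ℕ → Prog M → Prog M
  | 0, _ => skip
  | n + 1, p => .seq p (rep n p)

/-- Each pass reverses one item, and stacking the items reverses their order: hence `rv`. The
function `F` abstracts from the choice of source and destination stacks. -/
theorem execLE_rep {p : Prog M} {F : List (Option Bool) → List (Option Bool) → Store M} {k : ℕ}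
    (hF : ∀ s d, ExecLE skip (F s d) (F s d) 2)
    (h : ∀ l s d, ExecLE p (F (item l ++ s) d) (F s (item l.reverse ++ d)) (k * (item l).length))
    (L : List (List Bool)) (s d : List (Option Bool)) :
    ExecLE (rep L.length p) (F (encItems L ++ s) d) (F s (encItems (rv L) ++ d))
      (k * (encItems L).length + 2) := by
  induction L generalizing d with
  | nil => exact hF s d
  | cons l L ih =>
    have h1 := (h l (encItems L ++ s) d).seq (ih (item l.reverse ++ d))
    have h2 : rv (l :: L) = rv L ++ [l.reverse] := by simp [rv]
    rw [h2, encItems_append, encItems_cons, encItems_cons, encItems_nil, List.append_nil,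
      List.append_assoc, List.append_assoc, List.length_append, mul_add, add_assoc]
    exact h1

/-! ### Moving, copying and exchanging items -/

section moves

/-- Move an item from `A` to `B`. -/
def mvAB : Prog M := .seq (.push (.inl .B) none) (transfer (.inl .A) id (.inl .B) some)
/-- Move an item from `A` to `C`. -/
def mvAC : Prog M := .seq (.push (.inl .C) none) (transfer (.inl .A) id (.inl .C) some)
/-- Move an item from `B` to `A`. -/
def mvBA : Prog M := .seq (.push (.inl .A) none) (transfer (.inl .B) id (.inl .A) some)
/-- Move an item from `C` to `A`. -/
def mvCA : Prog M := .seq (.push (.inl .A) none) (transfer (.inl .C) id (.inl .A) some)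
/-- Move an item from `B` to `C`. -/
def mvBC : Prog M := .seq (.push (.inl .C) none) (transfer (.inl .B) id (.inl .C) some)
/-- Move an item from `C` to `B`. -/
def mvCB : Prog M := .seq (.push (.inl .B) none) (transfer (.inl .C) id (.inl .B) some)
/-- Discard an item. -/
def drop : Prog M := .loop (.inl .A) id skip skip
/-- Copy an item from `B` to `A` and `C`. -/
def cpB : Prog M :=
  .seq (.seq (.push (.inl .A) none) (.push (.inl .C) none))
    (.loop (.inl .B) id
      (.seq (.push (.inl .A) (some true)) (.push (.inl .C) (some true)))
      (.seq (.push (.inl .A) (some false)) (.push (.inl .C) (some false))))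

variable (l : List Bool) (a b c : List (Option Bool)) (q r : List Bool) (m : ∀ k, List (M.Γ k))

theorem execLE_mvAB : ExecLE mvAB (mk (item l ++ a) b c q r m) (mk a (item l.reverse ++ b) c q r m)
    (2 * (item l).length) := by
  have h1 := ExecLE.push (.inl .B) none (mk (item l ++ a) b c q r m)
  have h2 := execLE_transfer (M := M) (k := .inl .A) (k' := .inl .B) (by simp) (φ := id) (e := some)
    (fun _ => rfl) some l (r := none :: a) rfl (mk (item l ++ a) (none :: b) c q r m)
    (by simp [item])
  simp only [update_mk_A, update_mk_B, mk_B, List.tail_cons] at h1 h2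
  exact (h1.seq h2).congr rfl (by simp [item]) (by simp; omega)

theorem execLE_mvAC : ExecLE mvAC (mk (item l ++ a) b c q r m) (mk a b (item l.reverse ++ c) q r m)
    (2 * (item l).length) := by
  have h1 := ExecLE.push (.inl .C) none (mk (item l ++ a) b c q r m)
  have h2 := execLE_transfer (M := M) (k := .inl .A) (k' := .inl .C) (by simp) (φ := id) (e := some)
    (fun _ => rfl) some l (r := none :: a) rfl (mk (item l ++ a) b (none :: c) q r m)
    (by simp [item])
  simp only [update_mk_A, update_mk_C, mk_C, List.tail_cons] at h1 h2
  exact (h1.seq h2).congr rfl (by simp [item]) (by simp; omega)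

theorem execLE_mvBA : ExecLE mvBA (mk a (item l ++ b) c q r m) (mk (item l.reverse ++ a) b c q r m)
    (2 * (item l).length) := by
  have h1 := ExecLE.push (.inl .A) none (mk a (item l ++ b) c q r m)
  have h2 := execLE_transfer (M := M) (k := .inl .B) (k' := .inl .A) (by simp) (φ := id) (e := some)
    (fun _ => rfl) some l (r := none :: b) rfl (mk (none :: a) (item l ++ b) c q r m)
    (by simp [item])
  simp only [update_mk_A, update_mk_B, mk_A, List.tail_cons] at h1 h2
  exact (h1.seq h2).congr rfl (by simp [item]) (by simp; omega)

theorem execLE_mvBC : ExecLE mvBC (mk a (item l ++ b) c q r m) (mk a b (item l.reverse ++ c) q r m)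
    (2 * (item l).length) := by
  have h1 := ExecLE.push (.inl .C) none (mk a (item l ++ b) c q r m)
  have h2 := execLE_transfer (M := M) (k := .inl .B) (k' := .inl .C) (by simp) (φ := id) (e := some)
    (fun _ => rfl) some l (r := none :: b) rfl (mk a (item l ++ b) (none :: c) q r m)
    (by simp [item])
  simp only [update_mk_B, update_mk_C, mk_C, List.tail_cons] at h1 h2
  exact (h1.seq h2).congr rfl (by simp [item]) (by simp; omega)

theorem execLE_mvCA : ExecLE mvCA (mk a b (item l ++ c) q r m) (mk (item l.reverse ++ a) b c q r m)
    (2 * (item l).length) := by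
  have h1 := ExecLE.push (.inl .A) none (mk a b (item l ++ c) q r m)
  have h2 := execLE_transfer (M := M) (k := .inl .C) (k' := .inl .A) (by simp) (φ := id) (e := some)
    (fun _ => rfl) some l (r := none :: c) rfl (mk (none :: a) b (item l ++ c) q r m)
    (by simp [item])
  simp only [update_mk_A, update_mk_C, mk_A, List.tail_cons] at h1 h2
  exact (h1.seq h2).congr rfl (by simp [item]) (by simp; omega)

theorem execLE_mvCB : ExecLE mvCB (mk a b (item l ++ c) q r m) (mk a (item l.reverse ++ b) c q r m)
    (2 * (item l).length) := by
  have h1 := ExecLE.push (.inl .B) none (mk a b (item l ++ c) q r m)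
  have h2 := execLE_transfer (M := M) (k := .inl .C) (k' := .inl .B) (by simp) (φ := id) (e := some)
    (fun _ => rfl) some l (r := none :: c) rfl (mk a (none :: b) (item l ++ c) q r m)
    (by simp [item])
  simp only [update_mk_B, update_mk_C, mk_B, List.tail_cons] at h1 h2
  exact (h1.seq h2).congr rfl (by simp [item]) (by simp; omega)

theorem execLE_drop : ExecLE drop (mk (item l ++ a) b c q r m) (mk a b c q r m)
    (3 * (item l).length) := by
  induction l with
  | nil =>
    refine (ExecLE.loop_none (M := M) (k := .inl .A) (φ := id) (pt := skip) (pf := skip)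
      (S := mk (item [] ++ a) b c q r m) rfl).congr rfl (by simp [item]) (by simp)
  | cons x l ih =>
    refine (ExecLE.loop_some (k := .inl .A) (φ := id) (pt := skip) (pf := skip)
      (S := mk (item (x :: l) ++ a) b c q r m) x rfl (S' := mk (item l ++ a) b c q r m)
      (T := 2) ?_ ih).mono (by simp; omega)
    rw [Bool.cond_self, update_mk_A]
    exact execLE_skip _ _ _ _ _ _

theorem execLE_cpB_loop : ExecLE
    (.loop (.inl .B) id
      (.seq (.push (.inl .A) (some true)) (.push (.inl .C) (some true)))
      (.seq (.push (.inl .A) (some false)) (.push (.inl .C) (some false))))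
    (mk a (item l ++ b) c q r m)
    (mk (l.reverse.map some ++ a) b (l.reverse.map some ++ c) q r m)
    (3 * l.length + 1) := by
  induction l generalizing a c with
  | nil =>
    exact (ExecLE.loop_none (k := .inl .B) (S := mk a (item [] ++ b) c q r m) rfl).congr rfl
      (by simp [item]) (by simp)
  | cons x l ih =>
    have h := ih (some x :: a) (some x :: c)
    refine (ExecLE.loop_some (k := .inl .B) (φ := id)
      (S := mk a (item (x :: l) ++ b) c q r m) x rfl
      (S' := mk (some x :: a) (item l ++ b) (some x :: c) q r m)
      (T := 2) ?_ h).congr rfl (by simp) (by simp; omega)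
    · rw [update_mk_B]
      have h1 := ExecLE.push (.inl .A) (some x) (mk a (item l ++ b) c q r m)
      have h2 := ExecLE.push (.inl .C) (some x) (mk (some x :: a) (item l ++ b) c q r m)
      simp only [update_mk_A, update_mk_C, mk_A, mk_C] at h1 h2
      cases x <;> exact h1.seq h2

theorem execLE_cpB : ExecLE cpB (mk a (item l ++ b) c q r m)
    (mk (item l.reverse ++ a) b (item l.reverse ++ c) q r m) (3 * (item l).length) := by
  have h1 := ExecLE.push (.inl .A) none (mk a (item l ++ b) c q r m)
  have h2 := ExecLE.push (.inl .C) none (mk (none :: a) (item l ++ b) c q r m)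
  simp only [update_mk_A, update_mk_C, mk_A, mk_C] at h1 h2
  exact ((h1.seq h2).seq (execLE_cpB_loop l _ _ _ _ _ _)).congr rfl (by simp [item])
    (by simp; omega)

variable (L L' : List (List Bool))

theorem execLE_rep_mvAB : ExecLE (rep L.length mvAB) (mk (encItems L ++ a) b c q r m)
    (mk a (encItems (rv L) ++ b) c q r m) (2 * (encItems L).length + 2) :=
  execLE_rep (F := fun s d => mk s d c q r m) (fun _ _ => execLE_skip _ _ _ _ _ _)
    (fun _ _ _ => execLE_mvAB _ _ _ _ _ _ _) L a b

theorem execLE_rep_mvAC : ExecLE (rep L.length mvAC) (mk (encItems L ++ a) b c q r m)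
    (mk a b (encItems (rv L) ++ c) q r m) (2 * (encItems L).length + 2) :=
  execLE_rep (F := fun s d => mk s b d q r m) (fun _ _ => execLE_skip _ _ _ _ _ _)
    (fun _ _ _ => execLE_mvAC _ _ _ _ _ _ _) L a c

theorem execLE_rep_mvBA : ExecLE (rep L.length mvBA) (mk a (encItems (rv L) ++ b) c q r m)
    (mk (encItems L ++ a) b c q r m) (2 * (encItems L).length + 2) := by
  have := execLE_rep (F := fun s d => mk d s c q r m) (fun _ _ => execLE_skip _ _ _ _ _ _)
    (fun _ _ _ => execLE_mvBA _ _ _ _ _ _ _) (rv L) b a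
  simpa using this

theorem execLE_rep_mvCA : ExecLE (rep L.length mvCA) (mk a b (encItems (rv L) ++ c) q r m)
    (mk (encItems L ++ a) b c q r m) (2 * (encItems L).length + 2) := by
  have := execLE_rep (F := fun s d => mk d b s q r m) (fun _ _ => execLE_skip _ _ _ _ _ _)
    (fun _ _ _ => execLE_mvCA _ _ _ _ _ _ _) (rv L) c a
  simpa using this

theorem execLE_rep_mvCB : ExecLE (rep L.length mvCB) (mk a b (encItems L ++ c) q r m)
    (mk a (encItems (rv L) ++ b) c q r m) (2 * (encItems L).length + 2) :=
  execLE_rep (F := fun s d => mk a d s q r m) (fun _ _ => execLE_skip _ _ _ _ _ _)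
    (fun _ _ _ => execLE_mvCB _ _ _ _ _ _ _) L c b

theorem execLE_rep_cpB : ExecLE (rep L.length cpB) (mk a (encItems (rv L) ++ b) c q r m)
    (mk (encItems L ++ a) b (encItems L ++ c) q r m) (3 * (encItems L).length + 2) := by
  have := execLE_rep (F := fun s d => mk (d ++ a) s (d ++ c) q r m)
    (fun _ _ => execLE_skip _ _ _ _ _ _)
    (fun l s d => by simpa using execLE_cpB l (d ++ a) s (d ++ c) q r m) (rv L) b []
  simpa using this

theorem execLE_rep_drop : ExecLE (rep L.length drop) (mk (encItems L ++ a) b c q r m)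
    (mk a b c q r m) (3 * (encItems L).length + 2) :=
  execLE_rep (F := fun s _ => mk s b c q r m) (fun _ _ => execLE_skip _ _ _ _ _ _)
    (fun _ _ _ => execLE_drop _ _ _ _ _ _ _) L a []

/-- Duplicate the top `n` items of `A`. -/
def dup (n : ℕ) : Prog M :=
  .seq (.seq (rep n mvAB) (rep n cpB)) (.seq (rep n mvCB) (rep n mvBA))

theorem execLE_dup : ExecLE (dup L.length) (mk (encItems L ++ a) b c q r m)
    (mk (encItems L ++ (encItems L ++ a)) b c q r m) (9 * (encItems L).length + 8) := by
  -- Every move reverses. The copy that lands on `C` has the right orientation, so it takes two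
  -- further moves, through `B`, to reach `A` in the same orientation.
  refine (((execLE_rep_mvAB a b c q r m L).seq (execLE_rep_cpB a b c q r m L)).seq
    ((execLE_rep_mvCB (encItems L ++ a) b c q r m L).seq
      (execLE_rep_mvBA (encItems L ++ a) b c q r m L))).mono ?_
  omega

/-- Exchange the top `n` items of `A` with the following `n'` items. -/
def swap (n n' : ℕ) : Prog M :=
  .seq (.seq (rep n mvAB) (rep n' mvAC)) (.seq (rep n mvBA) (rep n' mvCA))

theorem execLE_swap : ExecLE (swap L.length L'.length)
    (mk (encItems L ++ (encItems L' ++ a)) b c q r m)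
    (mk (encItems L' ++ (encItems L ++ a)) b c q r m)
    (4 * (encItems L).length + 4 * (encItems L').length + 8) := by
  refine (((execLE_rep_mvAB _ b c q r m L).seq (execLE_rep_mvAC a _ c q r m L')).seq
    ((execLE_rep_mvBA a b _ q r m L).seq
      (execLE_rep_mvCA (encItems L ++ a) b c q r m L'))).mono ?_
  omega

end moves

/-! ### Functions computed by polynomial-time programs -/

/-- Types whose elements are represented by a fixed number of bit strings. -/
class Data (α : Type) where
  /-- the number of bit strings -/
  arity : ℕ
  /-- the bit strings -/
  items : α → List (List Bool)
  length_items : ∀ a, (items a).length = arity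

/-- The encoding of a value on a stack. -/
def enc {α : Type} [Data α] (a : α) : List (Option Bool) := encItems (Data.items a)

/-- The length of the encoding of a value. -/
def size {α : Type} [Data α] (a : α) : ℕ := (enc a).length

instance : Data (List Bool) := ⟨1, fun l => [l], fun _ => rfl⟩
instance : Data Bool := ⟨1, fun b => [[b]], fun _ => rfl⟩
instance : Data ℕ := ⟨1, fun n => [n.bits], fun _ => rfl⟩
instance {α β : Type} [Data α] [Data β] : Data (α × β) :=
  ⟨Data.arity α + Data.arity β, fun a => Data.items a.1 ++ Data.items a.2,
    fun a => by rw [List.length_append, Data.length_items, Data.length_items]⟩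

theorem enc_list (l : List Bool) : enc l = item l := by simp [enc, Data.items, encItems]
theorem enc_bool (b : Bool) : enc b = item [b] := by simp [enc, Data.items, encItems]
theorem enc_nat (n : ℕ) : enc n = item n.bits := by simp [enc, Data.items, encItems]
theorem enc_prod {α β : Type} [Data α] [Data β] (a : α × β) : enc a = enc a.1 ++ enc a.2 := by
  simp [enc, Data.items, encItems]

@[simp] theorem size_list (l : List Bool) : size l = l.length + 1 := by simp [size, enc_list]
@[simp] theorem size_bool (b : Bool) : size b = 2 := by simp [size, enc_bool]
theorem size_nat (n : ℕ) : size n = n.bits.length + 1 := by simp [size, enc_nat]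
@[simp] theorem size_prod {α β : Type} [Data α] [Data β] (a : α × β) :
    size a = size a.1 + size a.2 := by
  simp [size, enc_prod]

theorem eval_mono (P : Polynomial ℕ) : Monotone fun n => P.eval n := by
  intro m n h
  simp only [Polynomial.eval_eq_sum, Polynomial.sum]
  gcongr

/-- A store in which only the stacks `A`, `B`, `C` are used. -/
abbrev st (a b c : List (Option Bool)) : Store M := mk a b c [] [] fun _ => []

variable {α β γ : Type} [Data α] [Data β] [Data γ]

variable (M) in
/-- `f` is computed by a polynomial-time program with subroutine `M`. -/
@[fun_prop] def PT (f : α → β) : Prop :=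
  -- The bound on the output size makes the running time of a composition polynomial. The program
  -- has to work above arbitrary contents `r`, `b`, `c`, so that it can be used while other values
  -- are stored below.
  ∃ (p : Prog M) (P : Polynomial ℕ), ∀ a, size (f a) ≤ P.eval (size a) ∧
    ∀ r b c, ExecLE p (st (enc a ++ r) b c) (st (enc (f a) ++ r) b c) (P.eval (size a))

open Polynomial in
theorem PT.of_enc {f : α → β} (h : ∀ a, enc (f a) = enc a) : PT M f := by
  refine ⟨skip, X + 2, fun a => ⟨by simp [size, h], fun r b c => ?_⟩⟩
  rw [h]
  exact (execLE_skip _ _ _ _ _ _).mono (by simp)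

@[fun_prop] theorem PT.id' : PT M fun a : α => a := PT.of_enc fun _ => rfl

@[fun_prop] theorem PT.comp {g : β → γ} {f : α → β} (hg : PT M g) (hf : PT M f) :
    PT M fun a => g (f a) := by
  obtain ⟨p, P, hp⟩ := hf
  obtain ⟨p', P', hp'⟩ := hg
  refine ⟨.seq p p', P + P'.comp P, fun a => ?_⟩
  have h := eval_mono P' (hp a).1
  simp only [Polynomial.eval_add, Polynomial.eval_comp] at h ⊢
  exact ⟨((hp' _).1.trans h).trans (by omega), fun r b c =>
    (((hp a).2 r b c).seq ((hp' _).2 r b c)).mono (by omega)⟩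

open Polynomial in
-- The argument is duplicated, `g` runs on the upper copy, its result is exchanged with the other
-- copy, and `f` runs on that. Since pairs are stored side by side, this leaves the encoding of the
-- pair.
@[fun_prop] theorem PT.prodMk {f : α → β} {g : α → γ} (hf : PT M f) (hg : PT M g) :
    PT M fun a => (f a, g a) := by
  obtain ⟨p, P, hp⟩ := hf
  obtain ⟨p', P', hp'⟩ := hg
  refine ⟨.seq (.seq (dup (Data.arity α)) p') (.seq (swap (Data.arity γ) (Data.arity α)) p),
    13 * X + 16 + P + 5 * P', fun a => ⟨?_, fun r b c => ?_⟩⟩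
  · have h1 := (hp a).1
    have h2 := (hp' a).1
    simp
    omega
  · have h1 := execLE_dup (M := M) r b c [] [] (fun _ => []) (Data.items a)
    have h2 := (hp' a).2 (enc a ++ r) b c
    have h3 := execLE_swap (M := M) r b c [] [] (fun _ => []) (Data.items (g a)) (Data.items a)
    have h4 := (hp a).2 (enc (g a) ++ r) b c
    have h5 := (hp' a).1
    rw [Data.length_items] at h1
    rw [Data.length_items, Data.length_items] at h3
    refine ((h1.seq h2).seq (h3.seq h4)).congr rfl ?_ ?_
    · rw [enc_prod, List.append_assoc]
    · simp [size, enc] at h5 ⊢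
      omega

open Polynomial in
theorem PT.snd' : PT M fun a : α × β => a.2 := by
  refine ⟨rep (Data.arity α) drop, 3 * X + 2, fun a => ⟨by simp; omega, fun r b c => ?_⟩⟩
  have h := execLE_rep_drop (M := M) (enc a.2 ++ r) b c [] [] (fun _ => []) (Data.items a.1)
  rw [Data.length_items] at h
  rw [enc_prod, List.append_assoc]
  exact h.mono (by simp [size_prod]; simp [size, enc])

open Polynomial in
theorem PT.fst' : PT M fun a : α × β => a.1 := by
  refine ⟨.seq (.seq (rep (Data.arity α) mvAB) (rep (Data.arity β) drop)) (rep (Data.arity α) mvBA),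
    4 * X + 6, fun a => ⟨by simp; omega, fun r b c => ?_⟩⟩
  have h1 := execLE_rep_mvAB (M := M) (enc a.2 ++ r) b c [] [] (fun _ => []) (Data.items a.1)
  have h2 := execLE_rep_drop (M := M) r (encItems (rv (Data.items a.1)) ++ b) c [] [] (fun _ => [])
    (Data.items a.2)
  have h3 := execLE_rep_mvBA (M := M) r b c [] [] (fun _ => []) (Data.items a.1)
  rw [Data.length_items] at h1 h2 h3
  rw [enc_prod, List.append_assoc]
  exact ((h1.seq h2).seq h3).mono (by simp [size_prod]; simp [size, enc]; omega)

@[fun_prop] theorem PT.fst {f : α → β × γ} (hf : PT M f) : PT M fun a => (f a).1 := PT.fst'.comp hf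
@[fun_prop] theorem PT.snd {f : α → β × γ} (hf : PT M f) : PT M fun a => (f a).2 := PT.snd'.comp hf

/-- Push a list on the stack `A`. -/
def pushList : List (Option Bool) → Prog M
  | [] => skip
  | o :: l => .seq (pushList l) (.push (.inl .A) o)

theorem execLE_pushList (l a b c : List (Option Bool)) (q r : List Bool) (m : ∀ k, List (M.Γ k)) :
    ExecLE (pushList l) (mk a b c q r m) (mk (l ++ a) b c q r m) (l.length + 2) := by
  induction l with
  | nil => exact execLE_skip _ _ _ _ _ _
  | cons o l ih =>
    have h1 := ExecLE.push (.inl .A) o (mk (l ++ a) b c q r m)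
    simp only [update_mk_A, mk_A] at h1
    exact (ih.seq h1).mono (by simp)

open Polynomial in
@[fun_prop] theorem PT.const (y : β) : PT M fun _ : α => y := by
  refine ⟨.seq (rep (Data.arity α) drop) (pushList (enc y)), 3 * X + C (size y + 4),
    fun a => ⟨by simp; omega, fun r b c => ?_⟩⟩
  have h1 := execLE_rep_drop (M := M) r b c [] [] (fun _ => []) (Data.items a)
  have h2 := execLE_pushList (M := M) (enc y) r b c [] [] (fun _ => [])
  rw [Data.length_items] at h1
  exact (h1.seq h2).mono (by simp [size, enc]; omega)

open Polynomial in
theorem PT.cons' (x : Bool) : PT M fun l : List Bool => x :: l := by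
  refine ⟨.push (.inl .A) (some x), X + 1, fun a => ⟨by simp, fun r b c => ?_⟩⟩
  have h1 := ExecLE.push (.inl .A) (some x) (st (M := M) (enc a ++ r) b c)
  simp only [update_mk_A, mk_A] at h1
  exact h1.congr rfl (by simp [enc_list, item]) (by simp)

@[fun_prop] theorem PT.cons {f : α → List Bool} (x : Bool) (hf : PT M f) :
    PT M fun a => x :: f a := (PT.cons' x).comp hf

/-- Case distinction on a bit string. -/
def lcase {δ : Type} (l : List Bool) (n : δ) (t f : List Bool → δ) : δ :=
  match l with
  | [] => n
  | true :: l => t l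
  | false :: l => f l

open Polynomial in
theorem PT.lcase' {n : α → β} {t f : List Bool × α → β} (hn : PT M n) (ht : PT M t)
    (hf : PT M f) : PT M fun a : List Bool × α =>
      lcase a.1 (n a.2) (fun l => t (l, a.2)) (fun l => f (l, a.2)) := by
  obtain ⟨p₁, P₁, h₁⟩ := hn
  obtain ⟨p₂, P₂, h₂⟩ := ht
  obtain ⟨p₃, P₃, h₃⟩ := hf
  -- Popping one symbol removes the head of the list; for the empty list it removes the end marker,
  -- hence the whole item, and exactly `a` is left for `p₁`.
  refine ⟨.case (.inl .A) id p₂ p₃ p₁, P₁ + P₂ + P₃ + 1, fun ⟨l, a⟩ => ?_⟩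
  simp only [eval_add, eval_one]
  rcases l with _ | ⟨_ | _, l⟩
  · have h := eval_mono P₁ (show size a ≤ size (([] : List Bool), a) by simp)
    dsimp only at h
    refine ⟨(h₁ a).1.trans (by omega), fun r b c => ?_⟩
    refine (ExecLE.case_none rfl (T := P₁.eval (size a)) ?_).mono (by omega)
    exact ((h₁ a).2 r b c).congr (by simp [enc_prod, enc_list, item]) rfl le_rfl
  · have h := eval_mono P₃ (show size (l, a) ≤ size (false :: l, a) by simp)
    dsimp only at h
    refine ⟨(h₃ (l, a)).1.trans (by omega), fun r b c => ?_⟩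
    refine (ExecLE.case_some false rfl (T := P₃.eval (size (l, a))) ?_).mono (by omega)
    exact ((h₃ (l, a)).2 r b c).congr (by simp [enc_prod, enc_list, item]) rfl le_rfl
  · have h := eval_mono P₂ (show size (l, a) ≤ size (true :: l, a) by simp)
    dsimp only at h
    refine ⟨(h₂ (l, a)).1.trans (by omega), fun r b c => ?_⟩
    refine (ExecLE.case_some true rfl (T := P₂.eval (size (l, a))) ?_).mono (by omega)
    exact ((h₂ (l, a)).2 r b c).congr (by simp [enc_prod, enc_list, item]) rfl le_rfl

@[fun_prop] theorem PT.lcase {l : α → List Bool} {n : α → β} {t f : α → List Bool → β}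
    (hl : PT M l) (hn : PT M n) (ht : PT M fun x : List Bool × α => t x.2 x.1)
    (hf : PT M fun x : List Bool × α => f x.2 x.1) :
    PT M fun a => lcase (l a) (n a) (t a) (f a) :=
  (PT.lcase' hn ht hf).comp (hl.prodMk PT.id')

@[fun_prop] theorem PT.cond {c : α → Bool} {f g : α → β} (hc : PT M c) (hf : PT M f)
    (hg : PT M g) : PT M fun a => cond (c a) (f a) (g a) := by
  have h1 : PT M fun b : Bool => [b] := PT.of_enc fun b => by rw [enc_list, enc_bool]
  have h2 : PT M fun a => WeightedCounting.lcase [c a] (g a) (fun _ => f a) (fun _ => g a) := by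
    have := h1.comp hc
    fun_prop
  convert h2 using 2 with a
  cases c a <;> rfl

/-- Recursion on a bit string with polynomially bounded values. -/
theorem PT.foldr {l : γ → List Bool} {g : γ → α} {h : Bool → α → α} (hl : PT M l) (hg : PT M g)
    (ht : PT M (h true)) (hf : PT M (h false)) (R : Polynomial ℕ)
    (hR : ∀ x, ∀ l', l' <:+ l x → size (l'.foldr h (g x)) ≤ R.eval (size x)) :
    PT M fun x => (l x).foldr h (g x) := by
  obtain ⟨pt, Pt, ht⟩ := ht
  obtain ⟨pf, Pf, hf⟩ := hf
  obtain ⟨p, P, hp⟩ := hl.prodMk hg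
  -- The list waits on `C` in reverse order, so that the loop meets its last bit first, as `foldr`
  -- does. Here `l₁` is the reversed part still to come and `l₂` the suffix already folded;
  -- intermediate values are folds over suffixes, which is why `hR` bounds these.
  have key : ∀ (x : γ) (r b c : List (Option Bool)) (l₁ l₂ : List Bool),
      l₁.reverse ++ l₂ = l x →
      ExecLE (.loop (.inl .C) id pt pf)
        (st (enc (l₂.foldr h (g x)) ++ r) b (item l₁ ++ c))
        (st (enc ((l x).foldr h (g x)) ++ r) b c)
        (l₁.length * ((Pt + Pf).eval (R.eval (size x)) + 1) + 1) := by
    intro x r b c l₁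
    induction l₁ with
    | nil =>
      intro l₂ e
      have := ExecLE.loop_none (M := M) (k := .inl .C) (φ := _root_.id) (pt := pt) (pf := pf)
        (S := st (enc (l₂.foldr h (g x)) ++ r) b (item [] ++ c)) rfl
      rw [← e]
      simpa [item] using this
    | cons y l₁ ih =>
      intro l₂ e
      have e' : l₁.reverse ++ y :: l₂ = l x := by simpa using e
      have h1 := hR x l₂ ⟨l₁.reverse ++ [y], by simpa using e⟩
      have h2 := eval_mono Pt h1
      have h3 := eval_mono Pf h1
      dsimp only at h2 h3
      refine (ExecLE.loop_some y rfl (T := (Pt + Pf).eval (R.eval (size x))) ?_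
        (ih (y :: l₂) e')).mono ?_
      · rw [update_mk_C, Polynomial.eval_add]
        cases y
        · exact ((hf _).2 r b _).mono (by omega)
        · exact ((ht _).2 r b _).mono (by omega)
      · simp only [List.length_cons]; rw [add_mul]; omega
  refine ⟨.seq (.seq p mvAC) (.loop (.inl .C) _root_.id pt pf),
    P + 2 * P + P * ((Pt + Pf).comp R + 1) + 1 + R, fun x => ⟨?_, fun r b c => ?_⟩⟩
  · have := hR x _ (List.suffix_refl _)
    simp only [Polynomial.eval_add]
    omega
  · have h1 := (hp x).2 r b c
    have h2 := execLE_mvAC (M := M) (l x) (enc (g x) ++ r) b c [] [] (fun _ => [])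
    have h3 := key x r b c (l x).reverse [] (by simp)
    have h4 := (hp x).1
    simp only [size_prod, size_list, List.length_reverse] at h3 h4
    rw [enc_prod, List.append_assoc, enc_list] at h1
    refine ((h1.seq h2).seq h3).mono ?_
    have h5 : (l x).length * ((Pt + Pf).eval (R.eval (size x)) + 1) ≤
      P.eval (size x) * ((Pt + Pf).eval (R.eval (size x)) + 1) := Nat.mul_le_mul_right _ (by omega)
    simp only [Polynomial.eval_add, Polynomial.eval_mul, Polynomial.eval_comp, Polynomial.eval_one,
      Polynomial.eval_ofNat, length_item] at h5 ⊢
    omega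

/-- Reverse the item on top of `A`. -/
theorem PT.reverse' : PT M fun l : List Bool => l.reverse := by
  refine ⟨.seq (.seq mvAB mvBC) mvCA, 6 * Polynomial.X, fun l => ⟨by simp, fun r b c => ?_⟩⟩
  have h1 := execLE_mvAB (M := M) l r b c [] [] (fun _ => [])
  have h2 := execLE_mvBC (M := M) l.reverse r b c [] [] (fun _ => [])
  have h3 := execLE_mvCA (M := M) l.reverse.reverse r b c [] [] (fun _ => [])
  exact ((h1.seq h2).seq h3).congr (by simp [enc_list]) (by simp [enc_list]) (by simp; omega)

@[fun_prop] theorem PT.reverse {f : α → List Bool} (hf : PT M f) :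
    PT M fun a => (f a).reverse := PT.reverse'.comp hf

end WeightedCounting

namespace WeightedCounting

open Turing Function

variable {M : FinTM2} {α β γ : Type} [Data α] [Data β] [Data γ]

/-! ### Bit strings -/

theorem PT.size_le {f : α → β} (hf : PT M f) :
    ∃ P : Polynomial ℕ, ∀ a, size (f a) ≤ P.eval (size a) := by
  obtain ⟨_, P, h⟩ := hf
  exact ⟨P, fun a => (h a).1⟩

theorem foldr_const {δ : Type} (h : δ → δ) (l : List Bool) (a : δ) :
    l.foldr (fun _ => h) a = h^[l.length] a := by
  induction l with
  | nil => rfl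
  | cons b l ih => rw [List.foldr_cons, ih, List.length_cons, iterate_succ_apply']

/-- Iteration with polynomially bounded values. -/
theorem PT.iterate {l : γ → List Bool} {g : γ → α} {h : α → α} (hl : PT M l) (hg : PT M g)
    (hh : PT M h) (R : Polynomial ℕ)
    (hR : ∀ x, ∀ n ≤ (l x).length, size (h^[n] (g x)) ≤ R.eval (size x)) :
    PT M fun x => h^[(l x).length] (g x) := by
  have := PT.foldr (h := fun _ => h) hl hg hh hh R fun x l' hl' => by
    rw [foldr_const]; exact hR x _ hl'.length_le
  simpa only [foldr_const] using this

theorem PT.append' : PT M fun x : List Bool × List Bool => x.1 ++ x.2 := by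
  have := PT.foldr (M := M) (γ := List Bool × List Bool) (l := fun x => x.1) (g := fun x => x.2)
    (h := List.cons) (by fun_prop) (by fun_prop) (by fun_prop) (by fun_prop) Polynomial.X
    fun x l' hl' => by
      have := hl'.length_le
      rw [List.foldr_cons_eq_append]
      simp
      omega
  simpa using this

@[fun_prop] theorem PT.append {f g : α → List Bool} (hf : PT M f) (hg : PT M g) :
    PT M fun a => f a ++ g a := PT.append'.comp (hf.prodMk hg)

@[fun_prop] theorem PT.tail {f : α → List Bool} (hf : PT M f) : PT M fun a => (f a).tail := by
  have : PT M fun a => WeightedCounting.lcase (f a) [] (fun l => l) (fun l => l) := by fun_prop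
  convert this using 2 with a
  rcases f a with _ | ⟨_ | _, l⟩ <;> rfl

@[fun_prop] theorem PT.headD {f : α → List Bool} (hf : PT M f) :
    PT M fun a => (f a).headD false := by
  have : PT M fun a => WeightedCounting.lcase (f a) false (fun _ => true) (fun _ => false) := by
    fun_prop
  convert this using 2 with a
  rcases f a with _ | ⟨_ | _, l⟩ <;> rfl

@[fun_prop] theorem PT.isEmpty {f : α → List Bool} (hf : PT M f) :
    PT M fun a => (f a).isEmpty := by
  have : PT M fun a => WeightedCounting.lcase (f a) true (fun _ => false) (fun _ => false) := by
    fun_prop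
  convert this using 2 with a
  rcases f a with _ | ⟨_ | _, l⟩ <;> rfl

@[fun_prop] theorem PT.not {f : α → Bool} (hf : PT M f) : PT M fun a => !f a := by
  have : PT M fun a => bif f a then false else true := by fun_prop
  convert this using 2 with a
  cases f a <;> rfl

@[fun_prop] theorem PT.and {f g : α → Bool} (hf : PT M f) (hg : PT M g) :
    PT M fun a => f a && g a := by
  have : PT M fun a => bif f a then g a else false := by fun_prop
  convert this using 2 with a
  cases f a <;> rfl

@[fun_prop] theorem PT.or {f g : α → Bool} (hf : PT M f) (hg : PT M g) :
    PT M fun a => f a || g a := by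
  have : PT M fun a => bif f a then true else g a := by fun_prop
  convert this using 2 with a
  cases f a <;> rfl

@[fun_prop] theorem PT.xor {f g : α → Bool} (hf : PT M f) (hg : PT M g) :
    PT M fun a => f a ^^ g a := by
  have : PT M fun a => bif f a then !g a else g a := by fun_prop
  convert this using 2 with a
  cases f a <;> simp

@[fun_prop] theorem PT.cons_var {c : α → Bool} {f : α → List Bool} (hc : PT M c) (hf : PT M f) :
    PT M fun a => c a :: f a := by
  have : PT M fun a => bif c a then true :: f a else false :: f a := by fun_prop
  convert this using 2 with a
  cases c a <;> rfl

/-! ### Unary numbers as loop counters -/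

/-- Numbers in unary. -/
def unary (n : ℕ) : List Bool := List.replicate n true

@[simp] theorem length_unary (n : ℕ) : (unary n).length = n := by simp [unary]

theorem iterate_append_unary (n k j : ℕ) :
    (fun s : List Bool × List Bool => (s.1, s.1 ++ s.2))^[n] (unary k, unary j) =
      (unary k, unary (n * k + j)) := by
  induction n with
  | zero => simp
  | succ n ih =>
    rw [iterate_succ_apply', ih]
    simp only [unary, ← List.replicate_add]
    congr 2
    ring

open Polynomial in
theorem PT.unary_mul {f g : α → ℕ} (hf : PT M fun a => unary (f a))
    (hg : PT M fun a => unary (g a)) : PT M fun a => unary (f a * g a) := by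
  obtain ⟨P, hP⟩ := hf.size_le
  obtain ⟨Q, hQ⟩ := hg.size_le
  have h := PT.iterate (M := M) (h := fun s : List Bool × List Bool => (s.1, s.1 ++ s.2))
    hf (hg.prodMk (PT.const (unary 0))) (by fun_prop) (Q + P * Q + 1) fun a n hn => by
      have h1 := hP a
      have h2 := hQ a
      simp only [length_unary, size_list] at hn h1 h2
      rw [iterate_append_unary]
      have h3 : n * g a ≤ P.eval (size a) * Q.eval (size a) := Nat.mul_le_mul (by omega) (by omega)
      simp
      omega
  simp only [iterate_append_unary, length_unary, add_zero] at h
  exact PT.snd h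

theorem PT.unary_length : PT M fun l : List Bool => unary l.length := by
  have h := PT.iterate (M := M) (h := fun s : List Bool => true :: s) PT.id' (PT.const (unary 0))
    (by fun_prop) (Polynomial.X) fun l n hn => by
      have : (fun s : List Bool => true :: s)^[n] (unary 0) = unary n := by
        clear hn
        induction n with
        | zero => rfl
        | succ n ih => rw [iterate_succ_apply', ih]; rfl
      rw [this]
      simpa using hn
  convert h using 2 with l
  generalize l.length = n
  induction n with
  | zero => rfl
  | succ n ih => rw [iterate_succ_apply', ← ih]; rfl

/-- Evaluation of polynomials in unary. -/
theorem PT.unary_eval (P : Polynomial ℕ) {f : α → ℕ} (hf : PT M fun a => unary (f a)) :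
    PT M fun a => unary (P.eval (f a)) := by
  induction P using Polynomial.induction_on with
  | C a => simpa using PT.const (M := M) (α := α) (unary a)
  | add p q hp hq =>
    have := hp.append hq
    simpa only [Polynomial.eval_add, unary, List.replicate_add] using this
  | monomial n a ih =>
    have := ih.unary_mul hf
    simpa only [Polynomial.eval_mul, Polynomial.eval_pow, Polynomial.eval_C, Polynomial.eval_X,
      pow_succ, mul_assoc] using this

theorem PT.drop {k : α → ℕ} {f : α → List Bool} (hk : PT M fun a => unary (k a)) (hf : PT M f) :
    PT M fun a => (f a).drop (k a) := by
  have e : ∀ (n : ℕ) (l : List Bool), List.tail^[n] l = l.drop n := by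
    intro n l
    induction n with
    | zero => rfl
    | succ n ih => rw [iterate_succ_apply', ih, List.tail_drop]
  obtain ⟨P, hP⟩ := hf.size_le
  have h := PT.iterate hk hf (h := List.tail) (PT.tail PT.id') P fun a n _ => by
    have := hP a
    rw [e]
    simp at this ⊢
    omega
  simpa only [e, length_unary] using h

theorem PT.take {k : α → ℕ} {f : α → List Bool} (hk : PT M fun a => unary (k a)) (hf : PT M f) :
    PT M fun a => (f a).take (k a) := by
  -- One bit moves from the list to the accumulator, which therefore holds the prefix in reverse;
  -- nothing happens once the list is empty.
  let h : List Bool × List Bool → List Bool × List Bool := fun s =>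
    WeightedCounting.lcase s.1 s (fun l => (l, true :: s.2)) (fun l => (l, false :: s.2))
  have hh : PT M h := by fun_prop
  have e : ∀ (n : ℕ) (l : List Bool), h^[n] (l, []) = (l.drop n, (l.take n).reverse) := by
    intro n l
    induction n with
    | zero => rfl
    | succ n ih =>
      rw [iterate_succ_apply', ih, List.take_add_one, ← List.head?_drop, ← List.tail_drop]
      rcases hl : l.drop n with _ | ⟨_ | _, l'⟩ <;> simp [h, WeightedCounting.lcase]
  obtain ⟨P, hP⟩ := hf.size_le
  have h1 := PT.iterate (M := M) hk (hf.prodMk (PT.const [])) hh (P + 1) fun a n _ => by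
    have := hP a
    rw [e]
    simp at this ⊢
    omega
  simp only [e, length_unary] at h1
  have h2 := h1.snd.reverse
  simpa using h2

/-! ### Binary numbers -/

/-- The number with the given binary digits. -/
def ofBits (l : List Bool) : ℕ := l.foldr Nat.bit 0

@[simp] theorem ofBits_nil : ofBits [] = 0 := rfl

theorem ofBits_cons (b : Bool) (l : List Bool) : ofBits (b :: l) = 2 * ofBits l + b.toNat := by
  rw [ofBits, List.foldr_cons, Nat.bit_val]; rfl

@[simp] theorem ofBits_bits (n : ℕ) : ofBits n.bits = n := by
  induction n using Nat.binaryRec' with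
  | zero => rfl
  | bit b n h ih =>
    rw [Nat.bits_append_bit n b h]
    exact congrArg (Nat.bit b) ih

theorem ofBits_lt (l : List Bool) : ofBits l < 2 ^ l.length := by
  induction l with
  | nil => simp
  | cons b l ih =>
    rw [ofBits_cons, List.length_cons, pow_succ]
    cases b <;> simp <;> omega

theorem ofBits_append (l l' : List Bool) :
    ofBits (l ++ l') = ofBits l + 2 ^ l.length * ofBits l' := by
  induction l with
  | nil => simp
  | cons b l ih => rw [List.cons_append, ofBits_cons, ih, ofBits_cons, List.length_cons]; ring

theorem size_nat_le {n k : ℕ} (h : n < 2 ^ k) : size n ≤ k + 1 := by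
  rw [size_nat, Nat.size_eq_bits_len]
  simpa using Nat.size_le.2 h

theorem lt_two_pow_bits (n : ℕ) : n < 2 ^ n.bits.length := by
  rw [Nat.size_eq_bits_len]; exact Nat.lt_size_self n

theorem PT.of_bits {f : α → ℕ} (h : PT M fun a => (f a).bits) : PT M f := by
  obtain ⟨p, P, h⟩ := h
  exact ⟨p, P, fun a => by simpa only [size, enc_nat, enc_list] using h a⟩

@[fun_prop] theorem PT.bits {f : α → ℕ} (h : PT M f) : PT M fun a => (f a).bits := by
  obtain ⟨p, P, h⟩ := h
  exact ⟨p, P, fun a => by simpa only [size, enc_nat, enc_list] using h a⟩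

@[fun_prop] theorem PT.div2 {f : α → ℕ} (h : PT M f) : PT M fun a => (f a).div2 :=
  PT.of_bits <| by simpa only [Nat.div2_bits_eq_tail] using h.bits.tail

@[fun_prop] theorem PT.bodd {f : α → ℕ} (h : PT M f) : PT M fun a => (f a).bodd := by
  convert h.bits.headD using 2 with a
  rw [Nat.bodd_eq_bits_head]
  cases (f a).bits <;> rfl

@[fun_prop] theorem PT.beq_zero {f : α → ℕ} (h : PT M f) : PT M fun a => f a == 0 := by
  convert h.bits.isEmpty using 2 with a
  rcases Nat.eq_zero_or_pos (f a) with h | h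
  · simp [h]
  · have h1 := lt_two_pow_bits (f a)
    rcases h2 : (f a).bits with _ | ⟨b, l⟩
    · rw [h2] at h1; simp at h1; omega
    · simpa using h.ne'

@[fun_prop] theorem PT.bit {c : α → Bool} {f : α → ℕ} (hc : PT M c) (hf : PT M f) :
    PT M fun a => Nat.bit (c a) (f a) := by
  refine PT.of_bits ?_
  have : PT M fun a => bif (f a == 0) && !c a then [] else (c a :: (f a).bits) := by fun_prop
  convert this using 2 with a
  by_cases h : f a = 0
  · rw [h]
    cases c a <;> simp
  · have : (f a == 0) = false := by simpa using h
    rw [this, Nat.bits_append_bit _ _ (fun h' => absurd h' h)]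
    rfl

@[fun_prop] theorem PT.ofBits {f : α → List Bool} (hf : PT M f) : PT M fun a => ofBits (f a) := by
  obtain ⟨P, hP⟩ := hf.size_le
  refine PT.foldr hf (PT.const 0) (by fun_prop) (by fun_prop) P fun a l' hl' => ?_
  have h1 := size_nat_le (ofBits_lt l')
  have h2 := hl'.length_le
  have h3 := hP a
  simp only [size_list] at h3
  exact h1.trans (by omega)

/-! ### Binary arithmetic digit by digit -/

/-- One step of serial addition or subtraction with carry function `κ`. -/
def serialStep (κ : Bool → Bool → Bool → Bool) (s : (ℕ × ℕ) × Bool × List Bool) :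
    (ℕ × ℕ) × Bool × List Bool :=
  ((s.1.1.div2, s.1.2.div2), κ s.1.1.bodd s.1.2.bodd s.2.1,
    (s.1.1.bodd ^^ s.1.2.bodd ^^ s.2.1) :: s.2.2)

/-- Serial addition or subtraction with carry function `κ`. -/
def serial (κ : Bool → Bool → Bool → Bool) (m n : ℕ) : (ℕ × ℕ) × Bool × List Bool :=
  (serialStep κ)^[(m.bits ++ n.bits).length] ((m, n), false, [])

theorem serial_iterate_fst (κ : Bool → Bool → Bool → Bool) (m n k : ℕ) :
    ((serialStep κ)^[k] ((m, n), false, [])).1 = (m / 2 ^ k, n / 2 ^ k) ∧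
      ((serialStep κ)^[k] ((m, n), false, [])).2.2.length = k := by
  induction k with
  | zero => simp
  | succ k ih =>
    rw [iterate_succ_apply']
    simp [serialStep, ih, Nat.div2_val, Nat.div_div_eq_div_mul, pow_succ]

theorem bits_length_mono {m n : ℕ} (h : m ≤ n) : m.bits.length ≤ n.bits.length := by
  rw [Nat.size_eq_bits_len, Nat.size_eq_bits_len]; exact Nat.size_le_size h

theorem PT.serial {κ : Bool → Bool → Bool → Bool}
    (hκ : PT M fun x : (Bool × Bool) × Bool => κ x.1.1 x.1.2 x.2) {f g : α → ℕ} (hf : PT M f)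
    (hg : PT M g) : PT M fun a => serial κ (f a) (g a) := by
  obtain ⟨P, hP⟩ := hf.size_le
  obtain ⟨Q, hQ⟩ := hg.size_le
  have h1 : PT M fun s : (ℕ × ℕ) × Bool × List Bool => κ s.1.1.bodd s.1.2.bodd s.2.1 :=
    hκ.comp (f := fun s : (ℕ × ℕ) × Bool × List Bool => ((s.1.1.bodd, s.1.2.bodd), s.2.1))
      (by fun_prop)
  refine PT.iterate (M := M) (l := fun a => (f a).bits ++ (g a).bits)
    (g := fun a => ((f a, g a), false, [])) (by fun_prop) (by fun_prop)
    (by unfold serialStep; exact PT.prodMk (by fun_prop) (h1.prodMk (by fun_prop)))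
    (2 * P + 2 * Q + 3) fun a n hn => ?_
  obtain ⟨e1, e2⟩ := serial_iterate_fst κ (f a) (g a) n
  have h2 := hP a
  have h3 := hQ a
  have h4 := bits_length_mono (Nat.div_le_self (f a) (2 ^ n))
  have h5 := bits_length_mono (Nat.div_le_self (g a) (2 ^ n))
  simp only [size_prod, e1, size_list, e2, size_bool, size_nat, Polynomial.eval_add,
    Polynomial.eval_mul, Polynomial.eval_ofNat, List.length_append] at h2 h3 hn ⊢
  omega

/-- The carry of an addition. -/
def carry (a b c : Bool) : Bool := (a && b) || (c && (a || b))

/-- The carry of a subtraction. -/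
def borrow (a b c : Bool) : Bool := (!a && b) || (c && (!a || b))

/-- Output digits are collected most recent first, so their reversal is the low part of the result.
The unread high parts and the carry have weight `2 ^ k`; together with the low part they always
represent `m + n`. -/
theorem serial_add_invariant (m n k : ℕ) :
    let s := (serialStep carry)^[k] ((m, n), false, [])
    ofBits s.2.2.reverse + 2 ^ k * (s.1.1 + s.1.2 + s.2.1.toNat) = m + n := by
  induction k with
  | zero => simp
  | succ k ih =>
    have hl := (serial_iterate_fst carry m n k).2
    rw [iterate_succ_apply']
    generalize (serialStep carry)^[k] ((m, n), false, []) = s at ih hl ⊢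
    obtain ⟨⟨x, y⟩, c, l⟩ := s
    dsimp only at ih hl ⊢
    have hx := Nat.bodd_add_div2 x
    have hy := Nat.bodd_add_div2 y
    simp only [serialStep, List.reverse_cons, ofBits_append, ofBits_cons, ofBits_nil,
      List.length_reverse, hl]
    rw [← ih]
    clear ih
    generalize x.div2 = x', y.div2 = y', x.bodd = u, y.bodd = v at hx hy ⊢
    subst hx hy
    rw [pow_succ]
    cases u <;> cases v <;> cases c <;> simp [carry] <;> ring

theorem serial_sub_invariant (m n k : ℕ) :
    let s := (serialStep borrow)^[k] ((m, n), false, [])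
    (ofBits s.2.2.reverse + 2 ^ k * (s.1.1 - s.1.2 - s.2.1.toNat) : ℤ) = m - n := by
  induction k with
  | zero => simp
  | succ k ih =>
    have hl := (serial_iterate_fst borrow m n k).2
    rw [iterate_succ_apply']
    generalize (serialStep borrow)^[k] ((m, n), false, []) = s at ih hl ⊢
    obtain ⟨⟨x, y⟩, c, l⟩ := s
    dsimp only at ih hl ⊢
    have hx := Nat.bodd_add_div2 x
    have hy := Nat.bodd_add_div2 y
    simp only [serialStep, List.reverse_cons, ofBits_append, ofBits_cons, ofBits_nil,
      List.length_reverse, hl]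
    rw [← ih]
    clear ih
    generalize x.div2 = x', y.div2 = y', x.bodd = u, y.bodd = v at hx hy ⊢
    subst hx hy
    rw [pow_succ]
    cases u <;> cases v <;> cases c <;> simp [borrow] <;> ring

/-- The length of the concatenation dominates both digit counts, so `serial` runs until both
operands are exhausted, and no maximum has to be computed. -/
theorem lt_two_pow_bits_append (m n : ℕ) :
    m < 2 ^ (m.bits ++ n.bits).length ∧ n < 2 ^ (m.bits ++ n.bits).length := by
  rw [List.length_append, pow_add]
  have h1 := lt_two_pow_bits m
  have h2 := lt_two_pow_bits n
  exact ⟨h1.trans_le (Nat.le_mul_of_pos_right _ (by positivity)),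
    h2.trans_le (Nat.le_mul_of_pos_left _ (by positivity))⟩

theorem serial_carry (m n : ℕ) :
    ofBits ((serial carry m n).2.1 :: (serial carry m n).2.2).reverse = m + n := by
  have h1 := serial_add_invariant m n (m.bits ++ n.bits).length
  have h2 := serial_iterate_fst carry m n (m.bits ++ n.bits).length
  have h3 := lt_two_pow_bits_append m n
  rw [Nat.div_eq_of_lt h3.1, Nat.div_eq_of_lt h3.2] at h2
  change (serial carry m n).1 = _ ∧ _ at h2
  change ofBits (serial carry m n).2.2.reverse + _ * ((serial carry m n).1.1 +
    (serial carry m n).1.2 + (serial carry m n).2.1.toNat) = _ at h1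
  rw [h2.1] at h1
  rw [← h1, List.reverse_cons, ofBits_append, List.length_reverse, serial, h2.2, ofBits_cons]
  simp

/-- At the end the digits represent `m - n` plus `2 ^ k` times the borrow, and they are below `2 ^
k`. So a borrow remains exactly when `m < n`, where truncated subtraction gives `0`. -/
theorem serial_borrow (m n : ℕ) :
    (bif (serial borrow m n).2.1 then 0 else ofBits (serial borrow m n).2.2.reverse) = m - n := by
  have h1 := serial_sub_invariant m n (m.bits ++ n.bits).length
  have h2 := serial_iterate_fst borrow m n (m.bits ++ n.bits).length
  have h3 := lt_two_pow_bits_append m n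
  rw [Nat.div_eq_of_lt h3.1, Nat.div_eq_of_lt h3.2] at h2
  change (serial borrow m n).1 = _ ∧ (serial borrow m n).2.2.length = _ at h2
  change (ofBits (serial borrow m n).2.2.reverse + _ * ((serial borrow m n).1.1 -
    (serial borrow m n).1.2 - (serial borrow m n).2.1.toNat) : ℤ) = _ at h1
  rw [h2.1] at h1
  have h4 := ofBits_lt (serial borrow m n).2.2.reverse
  rw [List.length_reverse, h2.2] at h4
  zify at h4
  cases h : (serial borrow m n).2.1 <;> rw [h] at h1 <;> simp at h1 h4 ⊢ <;> omega

@[fun_prop] theorem PT.add {f g : α → ℕ} (hf : PT M f) (hg : PT M g) :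
    PT M fun a => f a + g a := by
  have h1 : PT M fun a => WeightedCounting.serial carry (f a) (g a) :=
    PT.serial (by unfold carry; fun_prop) hf hg
  have h2 := (h1.snd.fst.cons_var h1.snd.snd).reverse.ofBits
  simpa only [serial_carry] using h2

@[fun_prop] theorem PT.sub {f g : α → ℕ} (hf : PT M f) (hg : PT M g) :
    PT M fun a => f a - g a := by
  have h1 : PT M fun a => WeightedCounting.serial borrow (f a) (g a) :=
    PT.serial (by unfold borrow; fun_prop) hf hg
  have h2 := h1.snd.fst.cond (PT.const 0) h1.snd.snd.reverse.ofBits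
  simpa only [serial_borrow] using h2

@[fun_prop] theorem PT.ble {f g : α → ℕ} (hf : PT M f) (hg : PT M g) :
    PT M fun a => Nat.ble (f a) (g a) := by
  have h : PT M fun a => f a - g a == 0 := by fun_prop
  convert h using 2 with a
  rw [Bool.eq_iff_iff]
  simp [Nat.sub_eq_zero_iff_le]

@[fun_prop] theorem PT.blt {f g : α → ℕ} (hf : PT M f) (hg : PT M g) :
    PT M fun a => Nat.blt (f a) (g a) := by
  have h : PT M fun a => !Nat.ble (g a) (f a) := by fun_prop
  convert h using 2 with a
  rw [Bool.eq_iff_iff]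
  rw [Nat.blt_eq, Bool.not_eq_true', ← Bool.not_eq_true, Nat.ble_eq, not_le]

theorem PT.two_pow {f : α → ℕ} (hf : PT M fun a => unary (f a)) : PT M fun a => 2 ^ f a := by
  have e : ∀ n, (Nat.bit false)^[n] 1 = 2 ^ n := by
    intro n
    induction n with
    | zero => rfl
    | succ n ih => rw [iterate_succ_apply', ih, Nat.bit_false_apply, pow_succ, mul_comm]
  obtain ⟨P, hP⟩ := hf.size_le
  have h := PT.iterate (M := M) hf (g := fun _ => 1) (by fun_prop) (h := Nat.bit false)
    (by fun_prop) (P + 1) fun a n hn => by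
      have := hP a
      rw [e]
      simp only [size_list, length_unary, Polynomial.eval_add, Polynomial.eval_one] at hn this ⊢
      exact (size_nat_le (Nat.pow_lt_pow_right (by norm_num) (Nat.lt_succ_self n))).trans (by omega)
  simpa only [e, length_unary] using h

@[fun_prop] theorem PT.mul {f g : α → ℕ} (hf : PT M f) (hg : PT M g) :
    PT M fun a => f a * g a := by
  -- Horner's scheme over the digits of the second factor; the first component carries the first
  -- factor along.
  let h : Bool → ℕ × ℕ → ℕ × ℕ := fun b s => (s.1, 2 * s.2 + b.toNat * s.1)
  have e : ∀ (l : List Bool) (m : ℕ), l.foldr h (m, 0) = (m, m * WeightedCounting.ofBits l) := by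
    intro l m
    induction l with
    | nil => simp
    | cons b l ih => rw [List.foldr_cons, ih, ofBits_cons]; simp only [h]; congr 1; ring
  have h0 : PT M (h false) := by
    convert (by fun_prop : PT M fun s : ℕ × ℕ => (s.1, Nat.bit false s.2)) using 2
    simp [h]
  have h1 : PT M (h true) := by
    convert (by fun_prop : PT M fun s : ℕ × ℕ => (s.1, Nat.bit false s.2 + s.1)) using 2
    simp [h]
  obtain ⟨P, hP⟩ := hf.size_le
  obtain ⟨Q, hQ⟩ := hg.size_le
  have h2 := PT.foldr (M := M) (l := fun a => (g a).bits) (g := fun a => (f a, 0)) (h := h)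
    (by fun_prop) (by fun_prop) h1 h0 (2 * P + Q + 1) fun a l' hl' => by
      have h1 := hP a
      have h2 := hQ a
      have h3 := hl'.length_le
      have h4 : f a * WeightedCounting.ofBits l' < 2 ^ ((f a).bits.length + l'.length) := by
        rw [pow_add]
        exact Nat.mul_lt_mul'' (lt_two_pow_bits _) (ofBits_lt _)
      have h5 := size_nat_le h4
      rw [e, size_prod]
      simp only [Polynomial.eval_add, Polynomial.eval_mul, Polynomial.eval_ofNat,
        Polynomial.eval_one]
      rw [size_nat] at h1 h2
      rw [size_nat (f a)]
      omega
  simp only [e, ofBits_bits] at h2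
  exact h2.snd

/-- One step of long division by `s.1`, with quotient and remainder `s.2`. -/
def divStep (b : Bool) (s : ℕ × ℕ × ℕ) : ℕ × ℕ × ℕ :=
  bif Nat.ble s.1 (Nat.bit b s.2.2) then (s.1, Nat.bit true s.2.1, Nat.bit b s.2.2 - s.1)
  else (s.1, Nat.bit false s.2.1, Nat.bit b s.2.2)

/-- These bounds need no positivity of `d`, so they control the size of the state for every input,
including division by zero. -/
theorem divStep_foldr_le (l : List Bool) (d : ℕ) :
    (l.foldr divStep (d, 0, 0)).1 = d ∧ (l.foldr divStep (d, 0, 0)).2.1 < 2 ^ l.length ∧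
      (l.foldr divStep (d, 0, 0)).2.2 < 2 ^ l.length := by
  induction l with
  | nil => simp
  | cons b l ih =>
    rw [List.foldr_cons]
    generalize l.foldr divStep (d, 0, 0) = s at ih
    obtain ⟨rfl, h1, h2⟩ := ih
    rw [List.length_cons, pow_succ, divStep, Nat.bit_val]
    have hb := Bool.toNat_le b
    rcases Bool.eq_false_or_eq_true (Nat.ble s.1 (2 * s.2.2 + b.toNat)) with h | h <;>
      simp only [h, cond_true, cond_false, Nat.bit_val] <;> simp <;> omega

/-- Digits are listed least significant first, so `foldr` reads them from the top as in schoolbook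
division. A remainder below `d` becomes less than `2 * d` when a digit is appended, so one
subtraction suffices. -/
theorem divStep_foldr (l : List Bool) {d : ℕ} (hd : 0 < d) :
    (l.foldr divStep (d, 0, 0)).2.1 * d + (l.foldr divStep (d, 0, 0)).2.2 = ofBits l ∧
      (l.foldr divStep (d, 0, 0)).2.2 < d := by
  induction l with
  | nil => simpa
  | cons b l ih =>
    have h0 := (divStep_foldr_le l d).1
    rw [List.foldr_cons, ofBits_cons]
    generalize l.foldr divStep (d, 0, 0) = s at ih h0
    subst h0
    obtain ⟨h1, h2⟩ := ih
    rw [divStep, ← h1, Nat.bit_val]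
    have hb := Bool.toNat_le b
    rcases h : Nat.ble s.1 (2 * s.2.2 + b.toNat)
    · have h' : ¬ s.1 ≤ 2 * s.2.2 + b.toNat := fun h' => by
        rw [Nat.ble_eq_true_of_le h'] at h; cases h
      simp only [cond_false, Nat.bit_val]
      exact ⟨by simp; ring, by omega⟩
    · have h' := Nat.le_of_ble_eq_true h
      simp only [cond_true, Nat.bit_val]
      refine ⟨?_, by omega⟩
      zify [h']
      simp
      ring

theorem PT.divMod {f g : α → ℕ} (hf : PT M f) (hg : PT M g) :
    PT M fun a => (f a).bits.foldr divStep (g a, 0, 0) := by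
  obtain ⟨P, hP⟩ := hf.size_le
  obtain ⟨Q, hQ⟩ := hg.size_le
  refine PT.foldr (M := M) (l := fun a => (f a).bits) (g := fun a => (g a, 0, 0)) (h := divStep)
    (by fun_prop) (by fun_prop) (by unfold divStep; fun_prop) (by unfold divStep; fun_prop)
    (2 * P + Q) fun a l' hl' => ?_
  have h1 := hP a
  have h2 := hQ a
  have h3 := hl'.length_le
  obtain ⟨e, h4, h5⟩ := divStep_foldr_le l' (g a)
  have h6 := size_nat_le h4
  have h7 := size_nat_le h5
  rw [size_nat] at h1
  simp only [size_prod, e, Polynomial.eval_add, Polynomial.eval_mul, Polynomial.eval_ofNat]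
  omega

@[fun_prop] theorem PT.div {f g : α → ℕ} (hf : PT M f) (hg : PT M g) :
    PT M fun a => f a / g a := by
  have h1 := PT.divMod hf hg
  -- Long division by zero would return a quotient with all digits one, whereas the quotient is `0`
  -- by convention.
  have h2 : PT M fun a =>
      bif g a == 0 then 0 else ((f a).bits.foldr divStep (g a, 0, 0)).2.1 := by fun_prop
  convert h2 using 2 with a
  rcases Nat.eq_zero_or_pos (g a) with h | h
  · simp [h]
  · obtain ⟨h3, h4⟩ := divStep_foldr (f a).bits h
    rw [ofBits_bits] at h3
    rw [beq_false_of_ne h.ne', cond_false]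
    exact Nat.div_eq_of_lt_le (by omega) (by rw [add_mul]; omega)

@[fun_prop] theorem PT.mod {f g : α → ℕ} (hf : PT M f) (hg : PT M g) :
    PT M fun a => f a % g a := by
  have h : PT M fun a => f a - g a * (f a / g a) := by fun_prop
  convert h using 2 with a
  exact (Nat.sub_eq_of_eq_add (Nat.mod_add_div _ _).symm).symm

end WeightedCounting

namespace WeightedCounting

open Turing Function

variable {M : FinTM2} {α β γ : Type} [Data α] [Data β] [Data γ]

/-! ### Rational reconstruction by continued fractions -/

/-- One step of the extended Euclidean algorithm: consecutive remainders, and consecutive numerators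
and denominators of convergents. -/
def euclidStep (s : (ℕ × ℕ) × (ℕ × ℕ) × (ℕ × ℕ)) : (ℕ × ℕ) × (ℕ × ℕ) × (ℕ × ℕ) :=
  bif s.1.2 == 0 then s else
    ((s.1.2, s.1.1 % s.1.2), (s.1.1 / s.1.2 * s.2.1.1 + s.2.1.2, s.2.1.1),
      (s.1.1 / s.1.2 * s.2.2.1 + s.2.2.2, s.2.2.1))

theorem euclidStep_zero (r : ℕ) (h k : ℕ × ℕ) : euclidStep ((r, 0), h, k) = ((r, 0), h, k) := rfl

theorem euclidStep_pos {r₁ : ℕ} (hr : 0 < r₁) (r₀ h h' k k' : ℕ) :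
    euclidStep ((r₀, r₁), (h, h'), (k, k')) =
      ((r₁, r₀ % r₁), (r₀ / r₁ * h + h', h), (r₀ / r₁ * k + k', k)) := by
  rw [euclidStep, beq_false_of_ne hr.ne', cond_false]

theorem euclidStep_iterate_zero (n r : ℕ) (h k : ℕ × ℕ) :
    euclidStep^[n] ((r, 0), h, k) = ((r, 0), h, k) :=
  iterate_fixed (euclidStep_zero r h k) n

/-- The invariant of the extended Euclidean algorithm started with `N` and `D`. -/
def EuclidInv (N D : ℕ) : (ℕ × ℕ) × (ℕ × ℕ) × (ℕ × ℕ) → Prop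
  | ((r₀, r₁), (h, h'), (k, k')) =>
    N = h * r₀ + h' * r₁ ∧ D = k * r₀ + k' * r₁ ∧ (r₀ ≤ N + D ∧ r₁ ≤ N + D) ∧
      (h ≤ N + 1 ∧ h' ≤ N + 1) ∧ (k ≤ D + 1 ∧ k' ≤ D + 1) ∧
      (h * k' = h' * k + 1 ∨ h' * k = h * k' + 1)

/-- A step multiplies the coefficient matrix by one of determinant `-1`, so the two alternatives for
the determinant, written without subtraction, swap. -/
theorem EuclidInv.step {N D : ℕ} {s : (ℕ × ℕ) × (ℕ × ℕ) × (ℕ × ℕ)} (hs : EuclidInv N D s) :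
    EuclidInv N D (euclidStep s) := by
  obtain ⟨⟨r₀, r₁⟩, ⟨h, h'⟩, ⟨k, k'⟩⟩ := s
  rcases Nat.eq_zero_or_pos r₁ with rfl | hr
  · rwa [euclidStep_zero]
  obtain ⟨h1, h2, ⟨h3, h4⟩, ⟨h5, h6⟩, ⟨h7, h8⟩, h9⟩ := hs
  rw [euclidStep_pos hr]
  have e := Nat.mod_add_div r₀ r₁
  generalize r₀ % r₁ = m, r₀ / r₁ = t at e ⊢
  have h1' : N = (t * h + h') * r₁ + h * m := by rw [h1, ← e]; ring
  have h2' : D = (t * k + k') * r₁ + k * m := by rw [h2, ← e]; ring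
  -- As `r₁` is positive, the new coefficients are at most `N` and `D`; the slack of one in the
  -- invariant is for the initial coefficients `1`.
  have h3' := Nat.le_mul_of_pos_right (t * h + h') hr
  have h4' := Nat.le_mul_of_pos_right (t * k + k') hr
  refine ⟨h1', h2', ⟨h4, ?_⟩, ⟨by omega, h5⟩, ⟨by omega, h7⟩, ?_⟩
  · have : m ≤ r₀ := by rw [← e]; omega
    omega
  · rcases h9 with h9 | h9
    · right; linear_combination h9
    · left; linear_combination h9

theorem euclidInv_iterate (N D n : ℕ) :
    EuclidInv N D (euclidStep^[n] ((N, D), (1, 0), (0, 1))) := by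
  induction n with
  | zero => simp [EuclidInv]
  | succ n ih => rw [iterate_succ_apply']; exact ih.step

theorem fract_natCast_div (a b : ℕ) :
    Int.fract ((a : ℝ) / b) = ((a % b : ℕ) : ℝ) / b ∧ ⌊(a : ℝ) / b⌋ = (a / b : ℕ) := by
  have h1 : ⌊(a : ℝ) / b⌋ = (a / b : ℕ) := by
    rw [← Nat.floor_div_eq_div (K := ℝ), Int.natCast_floor_eq_floor (by positivity)]
  refine ⟨?_, h1⟩
  rcases Nat.eq_zero_or_pos b with rfl | hb
  · simp
  rw [Int.fract, h1]
  have h2 : (a : ℝ) = (a % b : ℕ) + b * (a / b : ℕ) := by exact_mod_cast (Nat.mod_add_div a b).symm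
  have : (b : ℝ) ≠ 0 := by positivity
  field_simp
  rw [Int.cast_natCast]
  linarith

/-- The extended Euclidean algorithm computes the convergents. -/
theorem euclidStep_convergent (n : ℕ) {r₀ r₁ : ℕ} (hr : 0 < r₁) :
    ∃ A B : ℕ, 0 < B ∧ (r₁ ≤ r₀ → 0 < A) ∧ (A / B : ℚ) = ((r₀ : ℝ) / r₁).convergent n ∧
      ∀ h h' k k', (euclidStep^[n + 1] ((r₀, r₁), (h, h'), (k, k'))).2.1.1 = h * A + h' * B ∧
        (euclidStep^[n + 1] ((r₀, r₁), (h, h'), (k, k'))).2.2.1 = k * A + k' * B := by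
  -- The recursion for convergents splits off the first partial quotient. The remaining steps are
  -- linear in the coefficients present at that moment, so the statement must hold for all of them.
  -- Positivity of `A` is carried along because the numerator for the tail becomes the next
  -- denominator.
  induction n generalizing r₀ r₁ with
  | zero =>
    refine ⟨r₀ / r₁, 1, one_pos, fun h => Nat.div_pos h hr, ?_, fun h h' k k' => ?_⟩
    · rw [Real.convergent_zero, (fract_natCast_div r₀ r₁).2, Int.cast_natCast, Nat.cast_one, div_one]
    · simp [euclidStep_pos hr, mul_comm]
  | succ n ih =>
    rw [Real.convergent_succ, (fract_natCast_div r₀ r₁).1, (fract_natCast_div r₀ r₁).2, inv_div]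
    -- When the remainder vanishes, the algorithm stands still and so do the convergents: the
    -- inverse of zero is zero, and the convergents of zero are zero.
    rcases Nat.eq_zero_or_pos (r₀ % r₁) with h0 | h0
    · refine ⟨r₀ / r₁, 1, one_pos, fun h => Nat.div_pos h hr, ?_, fun h h' k k' => ?_⟩
      · rw [Int.cast_natCast, h0, Nat.cast_zero, div_zero, Real.convergent_of_zero]; simp
      · rw [iterate_succ_apply, euclidStep_pos hr, h0, euclidStep_iterate_zero]
        simp [mul_comm]
    · obtain ⟨A, B, hB, hA, e, H⟩ := ih (r₀ := r₁) h0
      have hA := hA (Nat.mod_lt _ hr).le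
      refine ⟨r₀ / r₁ * A + B, A, hA, fun _ => by positivity, ?_, fun h h' k k' => ?_⟩
      · rw [← e, inv_div, Int.cast_natCast]
        have : (A : ℚ) ≠ 0 := by positivity
        push_cast
        field_simp
      · rw [iterate_succ_apply, euclidStep_pos hr]
        obtain ⟨H1, H2⟩ := H (r₀ / r₁ * h + h') h (r₀ / r₁ * k + k') k
        rw [H1, H2]
        exact ⟨by ring, by ring⟩

/-- For `0 < r₁ < r₀` one has `r₀ % r₁ ≤ r₀ / 2`, so each step at least halves the product of two
consecutive remainders. -/
theorem euclidStep_iterate_halves (n : ℕ) {s : (ℕ × ℕ) × (ℕ × ℕ) × (ℕ × ℕ)} (hs : s.1.2 < s.1.1) :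
    (euclidStep^[n] s).1.2 < (euclidStep^[n] s).1.1 ∧
      (euclidStep^[n] s).1.1 * (euclidStep^[n] s).1.2 * 2 ^ n ≤ s.1.1 * s.1.2 := by
  induction n with
  | zero => simpa
  | succ n ih =>
    rw [iterate_succ_apply']
    generalize euclidStep^[n] s = u at ih
    obtain ⟨⟨r₀, r₁⟩, ⟨h, h'⟩, ⟨k, k'⟩⟩ := u
    obtain ⟨h1, h2⟩ := ih
    rcases Nat.eq_zero_or_pos r₁ with rfl | hr
    · exact ⟨h1, by simp [euclidStep_zero]⟩
    · rw [euclidStep_pos hr]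
      have h3 := Nat.mod_lt r₀ hr
      refine ⟨h3, le_trans ?_ h2⟩
      dsimp only at h1 ⊢
      have e := Nat.mod_add_div r₀ r₁
      have ht : 1 ≤ r₀ / r₁ := Nat.div_pos h1.le hr
      have h4 : r₁ ≤ r₁ * (r₀ / r₁) := Nat.le_mul_of_pos_right _ ht
      have h5 : r₀ % r₁ * 2 ≤ r₀ := by omega
      calc r₁ * (r₀ % r₁) * 2 ^ (n + 1) = (r₁ * 2 ^ n) * (r₀ % r₁ * 2) := by ring
        _ ≤ (r₁ * 2 ^ n) * r₀ := Nat.mul_le_mul_left _ h5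
        _ = r₀ * r₁ * 2 ^ n := by ring

/-- The extra first step puts the remainders in decreasing order. Afterwards their product is at
most `N * D`, so `n` halvings bring it to zero. -/
theorem euclidStep_iterate_eq_zero {N D n : ℕ} (hD : 0 < D) (h : N * D < 2 ^ n) :
    (euclidStep^[n + 1] ((N, D), (1, 0), (0, 1))).1.2 = 0 := by
  rw [iterate_succ_apply, euclidStep_pos hD]
  obtain ⟨h1, h2⟩ := euclidStep_iterate_halves n
    (s := ((D, N % D), (N / D * 1 + 0, 1), (N / D * 0 + 1, 0))) (Nat.mod_lt _ hD)
  generalize euclidStep^[n] ((D, N % D), (N / D * 1 + 0, 1), (N / D * 0 + 1, 0)) = s at h1 h2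
  by_contra h0
  have h3 : D * (N % D) ≤ N * D := by
    rw [mul_comm]; exact Nat.mul_le_mul_right _ (Nat.mod_le _ _)
  have h4 : 1 ≤ s.1.1 * s.1.2 := Nat.mul_pos (by omega) (by omega)
  have h5 : 1 * 2 ^ n ≤ s.1.1 * s.1.2 * 2 ^ n := Nat.mul_le_mul_right _ h4
  dsimp only at h2
  omega

/-! ### Selecting the right convergent -/

/-- Update the best approximation found so far. -/
def select (u : (ℕ × ℕ) × ((ℕ × ℕ) × (ℕ × ℕ) × (ℕ × ℕ)) × (ℕ × ℕ)) :
    (ℕ × ℕ) × ((ℕ × ℕ) × (ℕ × ℕ) × (ℕ × ℕ)) × (ℕ × ℕ) :=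
  (u.1, u.2.1, bif Nat.ble u.2.1.1.2 (u.2.1.2.2.1 * u.1.1) && Nat.blt u.2.1.2.2.1 u.1.2
    then (u.2.1.2.1.1, u.2.1.2.2.1) else u.2.2)

/-- One step of the search for a good approximation. -/
def searchStep (u : (ℕ × ℕ) × ((ℕ × ℕ) × (ℕ × ℕ) × (ℕ × ℕ)) × (ℕ × ℕ)) :
    (ℕ × ℕ) × ((ℕ × ℕ) × (ℕ × ℕ) × (ℕ × ℕ)) × (ℕ × ℕ) :=
  select (u.1, euclidStep u.2.1, u.2.2)

/-- The state of the search after `n` steps. -/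
def searchState (X Q N D n : ℕ) : (ℕ × ℕ) × ((ℕ × ℕ) × (ℕ × ℕ) × (ℕ × ℕ)) × (ℕ × ℕ) :=
  searchStep^[n] ((X, Q), ((N, D), (1, 0), (0, 1)), (0, 0))

/-- Numerator and denominator of a fraction with denominator less than `Q` and distance at most
`X / D` from `N / D`. -/
def search (X Q N D : ℕ) : ℕ × ℕ :=
  (searchState X Q N D (true :: (N * D).bits).length).2.2

theorem searchState_fst (X Q N D n : ℕ) : (searchState X Q N D n).1 = (X, Q) := by
  induction n with
  | zero => rfl
  | succ n ih => rw [searchState, iterate_succ_apply', ← searchState]; exact ih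

theorem searchState_snd_fst (X Q N D n : ℕ) :
    (searchState X Q N D n).2.1 = euclidStep^[n] ((N, D), (1, 0), (0, 1)) := by
  induction n with
  | zero => rfl
  | succ n ih =>
    rw [searchState, iterate_succ_apply', ← searchState, iterate_succ_apply', ← ih]; rfl

theorem searchState_snd_snd (X Q N D n : ℕ) :
    (searchState X Q N D (n + 1)).2.2 =
      let s := euclidStep^[n + 1] ((N, D), (1, 0), (0, 1))
      bif Nat.ble s.1.2 (s.2.2.1 * X) && Nat.blt s.2.2.1 Q then (s.2.1.1, s.2.2.1)
      else (searchState X Q N D n).2.2 := by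
  rw [searchState, iterate_succ_apply', ← searchState, searchStep, searchState_fst,
    searchState_snd_fst, iterate_succ_apply']
  rfl

theorem searchState_le (X Q N D n : ℕ) :
    (searchState X Q N D n).2.2.1 ≤ N + 1 ∧ (searchState X Q N D n).2.2.2 ≤ D + 1 := by
  induction n with
  | zero => simp [searchState]
  | succ n ih =>
    rw [searchState_snd_snd]
    have h := euclidInv_iterate N D (n + 1)
    generalize euclidStep^[n + 1] ((N, D), (1, 0), (0, 1)) = s at h
    obtain ⟨⟨r₀, r₁⟩, ⟨h, h'⟩, ⟨k, k'⟩⟩ := s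
    obtain ⟨-, -, -, h1, h2, -⟩ := h
    dsimp only
    cases Nat.ble r₁ (k * X) && Nat.blt k Q
    · exact ih
    · exact ⟨h1.1, h2.1⟩

theorem PT.search {X Q N D : α → ℕ} (hX : PT M X) (hQ : PT M Q) (hN : PT M N) (hD : PT M D) :
    PT M fun a => search (X a) (Q a) (N a) (D a) := by
  obtain ⟨P₁, h₁⟩ := hX.size_le
  obtain ⟨P₂, h₂⟩ := hQ.size_le
  obtain ⟨P₃, h₃⟩ := hN.size_le
  obtain ⟨P₄, h₄⟩ := hD.size_le
  have he : PT M euclidStep := by unfold euclidStep; fun_prop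
  have hs : PT M select := by unfold select; fun_prop
  have hstep : PT M searchStep := by unfold searchStep; fun_prop
  have h := PT.iterate (M := M) (l := fun a => true :: (N a * D a).bits)
    (g := fun a => ((X a, Q a), ((N a, D a), (1, 0), (0, 1)), (0, 0))) (by fun_prop) (by fun_prop)
    -- Eight numbers vary: two remainders, four coefficients and the stored fraction. Each is at
    -- most `N + D + 1`.
    hstep (P₁ + P₂ + 8 * (P₃ + P₄ + 2)) fun a n _ => by
      change size (searchState (X a) (Q a) (N a) (D a) n) ≤ _
      have e1 := searchState_fst (X a) (Q a) (N a) (D a) n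
      have e2 := searchState_snd_fst (X a) (Q a) (N a) (D a) n
      have e3 := searchState_le (X a) (Q a) (N a) (D a) n
      have e4 := euclidInv_iterate (N a) (D a) n
      rw [← e2] at e4
      clear e2
      generalize searchState (X a) (Q a) (N a) (D a) n = u at e1 e3 e4
      obtain ⟨⟨x, y⟩, ⟨⟨r₀, r₁⟩, ⟨h, h'⟩, ⟨k, k'⟩⟩, ⟨f, g⟩⟩ := u
      obtain ⟨-, -, ⟨h3, h4⟩, ⟨h5, h6⟩, ⟨h7, h8⟩, -⟩ := e4
      cases e1
      have key : ∀ m, m ≤ N a + D a + 1 → size m ≤ size (N a) + size (D a) + 2 := by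
        intro m hm
        have b1 := lt_two_pow_bits (N a)
        have b2 := lt_two_pow_bits (D a)
        rw [size_nat (N a), size_nat (D a)]
        generalize (N a).bits.length = i at *
        generalize (D a).bits.length = j at *
        have b3 : 2 ^ i ≤ 2 ^ (i + j) := Nat.pow_le_pow_right (by norm_num) (by omega)
        have b4 : 2 ^ j ≤ 2 ^ (i + j) := Nat.pow_le_pow_right (by norm_num) (by omega)
        have b5 : m < 2 ^ (i + j + 1) := by rw [pow_succ]; omega
        have := size_nat_le b5
        omega
      have k1 := key r₀ (by omega)
      have k2 := key r₁ (by omega)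
      have k3 := key h (by omega)
      have k4 := key h' (by omega)
      have k5 := key k (by omega)
      have k6 := key k' (by omega)
      have k7 := key f (by simp at e3; omega)
      have k8 := key g (by simp at e3; omega)
      have := h₁ a
      have := h₂ a
      have := h₃ a
      have := h₄ a
      simp only [size_prod, Polynomial.eval_add, Polynomial.eval_mul, Polynomial.eval_ofNat]
      omega
  exact h.snd.snd

/-- The search finds every fraction with small denominator that is sufficiently close. -/
theorem search_eq {X Q N D : ℕ} (hX : 0 < X) (hQ : 0 < Q) (hD : 4 * X * Q ^ 2 ≤ D) {r : ℚ}
    (hden : r.den < Q) (hr : |(N : ℝ) / D - r| ≤ (X : ℝ) / D) :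
    ((search X Q N D).1 : ℤ) = r.num ∧ (search X Q N D).2 = r.den := by
  have hD0 : 0 < D := lt_of_lt_of_le (by positivity) hD
  have hDR : (0 : ℝ) < D := by exact_mod_cast hD0
  have hDR' : 4 * (X : ℝ) * Q ^ 2 ≤ D := by exact_mod_cast hD
  have hXR : (0 : ℝ) < X := by exact_mod_cast hX
  have hQR : (0 : ℝ) < Q := by exact_mod_cast hQ
  have hdR : (0 : ℝ) < r.den := by exact_mod_cast r.pos
  have hdQ : (r.den : ℝ) < Q := by exact_mod_cast hden
  have hXD : (X : ℝ) / D * (4 * Q ^ 2) ≤ 1 := by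
    rw [div_mul_eq_mul_div, div_le_one hDR]; linarith
  let good : ℕ × ℕ → Prop := fun p => (p.1 : ℤ) = r.num ∧ p.2 = r.den
  have coprime_good : ∀ h k : ℕ, h.Coprime k → 0 < k → (h : ℚ) / k = r → good (h, k) := by
    intro h k hc hk e
    have e' : ((h : ℤ) : ℚ) / ((k : ℤ) : ℚ) = r := by simpa using e
    have h1 := Rat.num_div_eq_of_coprime (a := h) (b := k) (by exact_mod_cast hk) (by simpa using hc)
    have h2 := Rat.den_div_eq_of_coprime (a := h) (b := k) (by exact_mod_cast hk) (by simpa using hc)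
    rw [e'] at h1 h2
    exact ⟨h1.symm, by exact_mod_cast h2.symm⟩
  -- The determinant `±1` gives coprimality, and also `|h * D - k * N| = r₁`: the remainder measures
  -- the distance of `h / k` from `N / D`.
  have inv : ∀ n, let s := euclidStep^[n] ((N, D), (1, 0), (0, 1));
      s.2.1.1.Coprime s.2.2.1 ∧ |(s.2.1.1 : ℝ) * D - s.2.2.1 * N| = s.1.2 ∧
        (s.2.2.1 = 0 → s.1.2 ≠ 0) := by
    intro n
    have h := euclidInv_iterate N D n
    generalize euclidStep^[n] ((N, D), (1, 0), (0, 1)) = s at h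
    obtain ⟨⟨r₀, r₁⟩, ⟨h, h'⟩, ⟨k, k'⟩⟩ := s
    obtain ⟨h1, h2, -, -, -, h3⟩ := h
    dsimp only
    refine ⟨?_, ?_, ?_⟩
    · rcases h3 with h3 | h3
      · refine Nat.isCoprime_iff_coprime.1 ⟨k', -h', ?_⟩
        zify at h3
        linear_combination h3
      · refine Nat.isCoprime_iff_coprime.1 ⟨-k', h', ?_⟩
        zify at h3
        linear_combination h3
    · have h1' : (N : ℝ) = h * r₀ + h' * r₁ := by exact_mod_cast h1
      have h2' : (D : ℝ) = k * r₀ + k' * r₁ := by exact_mod_cast h2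
      have e : (h : ℝ) * D - k * N = (h * k' - h' * k) * r₁ := by rw [h1', h2']; ring
      rw [e]
      rcases h3 with h3 | h3
      · have h3' : (h * k' : ℝ) = h' * k + 1 := by exact_mod_cast h3
        rw [h3']; simp
      · have h3' : (h' * k : ℝ) = h * k' + 1 := by exact_mod_cast h3
        rw [h3']; simp
    · rintro rfl rfl
      simp at h2
      omega
  -- The test `r₁ ≤ k * X` says that `h / k` is within `X / D` of `N / D`, hence within `2 * X / D ≤
  -- 1 / (2 * Q ^ 2)` of `r`. If the two differed, their distance would be at least `1 / (k * r.den)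
  -- > 1 / Q ^ 2`.
  have cond_good : ∀ n, let s := euclidStep^[n] ((N, D), (1, 0), (0, 1));
      s.1.2 ≤ s.2.2.1 * X → s.2.2.1 < Q → good (s.2.1.1, s.2.2.1) := by
    intro n
    obtain ⟨h1, h2, h3⟩ := inv n
    generalize euclidStep^[n] ((N, D), (1, 0), (0, 1)) = s at h1 h2 h3
    obtain ⟨⟨r₀, r₁⟩, ⟨h, h'⟩, ⟨k, k'⟩⟩ := s
    dsimp only at h1 h2 h3 ⊢
    intro h4 h5
    have hk : 0 < k := by
      rcases Nat.eq_zero_or_pos k with rfl | hk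
      · simp at h4; exact absurd h4 (h3 rfl)
      · exact hk
    have hkR : (0 : ℝ) < k := by exact_mod_cast hk
    have hkQ : (k : ℝ) < Q := by exact_mod_cast h5
    refine coprime_good h k h1 hk ?_
    have h6 : |(h : ℝ) / k - N / D| ≤ X / D := by
      have e : (h : ℝ) / k - N / D = (h * D - k * N) / (k * D) := by field_simp
      rw [e, abs_div, h2, abs_of_pos (by positivity : (0 : ℝ) < k * D), div_le_div_iff₀ (by positivity)
        hDR]
      have h4' : (r₁ : ℝ) ≤ k * X := by exact_mod_cast h4
      nlinarith
    have h7 : |(h : ℝ) / k - r| ≤ 2 * (X / D) := by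
      have := abs_sub_le ((h : ℝ) / k) (N / D) r
      linarith
    have er : (r : ℝ) = r.num / r.den := by exact_mod_cast (Rat.num_div_den r).symm
    have e2 : (h : ℝ) / k - r = ((h * r.den - k * r.num : ℤ) : ℝ) / (k * r.den) := by
      rw [er]; push_cast; field_simp
    have h8 : (h * r.den - k * r.num : ℤ) = 0 := by
      by_contra h0
      have h9 : (1 : ℝ) ≤ |((h * r.den - k * r.num : ℤ) : ℝ)| := by
        exact_mod_cast Int.one_le_abs h0
      rw [e2, abs_div, abs_of_pos (by positivity : (0 : ℝ) < k * r.den),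
        div_le_iff₀ (by positivity)] at h7
      have h10 : (k : ℝ) * r.den ≤ Q ^ 2 := by
        rw [sq]; exact mul_le_mul hkQ.le hdQ.le hdR.le hQR.le
      have h11 : 2 * ((X : ℝ) / D) * (k * r.den) ≤ 2 * ((X : ℝ) / D) * Q ^ 2 :=
        mul_le_mul_of_nonneg_left h10 (by positivity)
      nlinarith
    rw [h8, Int.cast_zero, zero_div, sub_eq_zero] at e2
    have e3 : (((h : ℚ) / k : ℚ) : ℝ) = r := by push_cast; exact e2
    exact_mod_cast e3
  -- The distance `X / D` is below `1 / (2 * r.den ^ 2)`, so Legendre's theorem makes `r` a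
  -- convergent, and this convergent passes the test.
  have exists_cond : ∃ n, n + 1 ≤ (true :: (N * D).bits).length ∧
      let s := euclidStep^[n + 1] ((N, D), (1, 0), (0, 1));
      s.1.2 ≤ s.2.2.1 * X ∧ s.2.2.1 < Q := by
    obtain ⟨n, hn⟩ : ∃ n, r = ((N : ℝ) / D).convergent n := by
      refine Real.exists_rat_eq_convergent (hr.trans_lt ?_)
      rw [lt_div_iff₀ (by positivity)]
      have : (X : ℝ) / D * (2 * r.den ^ 2) ≤ X / D * (2 * Q ^ 2) := by gcongr
      nlinarith
    obtain ⟨A, B, hB, -, hAB, H⟩ := euclidStep_convergent n (r₀ := N) hD0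
    obtain ⟨H1, H2⟩ := H 1 0 0 1
    have hbits := lt_two_pow_bits (N * D)
    have hz := euclidStep_iterate_eq_zero hD0 hbits
    -- The index from Legendre's theorem may exceed the number of search steps, but by then the
    -- algorithm is stationary.
    refine ⟨min n (N * D).bits.length, by simp, ?_⟩
    have hmin : euclidStep^[min n (N * D).bits.length + 1] ((N, D), (1, 0), (0, 1)) =
        euclidStep^[n + 1] ((N, D), (1, 0), (0, 1)) := by
      rcases le_total n (N * D).bits.length with h | h
      · rw [min_eq_left h]
      · rw [min_eq_right h]
        obtain ⟨j, rfl⟩ := Nat.exists_eq_add_of_le' h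
        rw [add_assoc, iterate_add_apply _ j]
        generalize euclidStep^[(N * D).bits.length + 1] ((N, D), (1, 0), (0, 1)) = s at hz
        obtain ⟨⟨r₀, r₁⟩, h, k⟩ := s
        cases hz
        exact (euclidStep_iterate_zero _ _ _ _).symm
    rw [hmin]
    obtain ⟨h1, h2, -⟩ := inv (n + 1)
    generalize euclidStep^[n + 1] ((N, D), (1, 0), (0, 1)) = s at H1 H2 h1 h2
    obtain ⟨⟨r₀, r₁⟩, ⟨h, h'⟩, ⟨k, k'⟩⟩ := s
    simp only [one_mul, zero_mul, add_zero, zero_add] at H1 H2 h1 h2 ⊢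
    subst H1 H2
    rw [← hn] at hAB
    obtain ⟨-, hk⟩ := coprime_good h k h1 hB hAB
    refine ⟨?_, by dsimp only at hk; omega⟩
    have hkR : (0 : ℝ) < k := by exact_mod_cast hB
    have e : (r : ℝ) = h / k := by rw [← hAB]; push_cast; rfl
    have e2 : (h : ℝ) * D - k * N = -((N : ℝ) / D - r) * (k * D) := by
      rw [e]; field_simp; ring
    rw [e2, abs_mul, abs_neg, abs_of_pos (by positivity : (0 : ℝ) < k * D)] at h2
    have : (r₁ : ℝ) ≤ k * X := by
      rw [← h2]
      calc |(N : ℝ) / D - r| * (k * D) ≤ X / D * (k * D) := by gcongr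
        _ = k * X := by field_simp
    exact_mod_cast this
  obtain ⟨n, hn, hc⟩ := exists_cond
  change good (searchState X Q N D (true :: (N * D).bits).length).2.2
  generalize (true :: (N * D).bits).length = L at hn
  obtain ⟨j, rfl⟩ := Nat.exists_eq_add_of_le hn
  -- After the first success the stored pair stays correct, because by `cond_good` later updates
  -- only store correct pairs.
  induction j with
  | zero =>
    rw [add_zero, searchState_snd_snd]
    have := cond_good (n + 1) hc.1 hc.2
    dsimp only at hc ⊢
    rw [Nat.ble_eq_true_of_le hc.1, Eq.mpr Nat.blt_eq hc.2]
    exact this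
  | succ j ih =>
    rw [← add_assoc, searchState_snd_snd]
    dsimp only
    cases h : Nat.ble (euclidStep^[n + 1 + j + 1] ((N, D), (1, 0), (0, 1))).1.2
      ((euclidStep^[n + 1 + j + 1] ((N, D), (1, 0), (0, 1))).2.2.1 * X) &&
      Nat.blt (euclidStep^[n + 1 + j + 1] ((N, D), (1, 0), (0, 1))).2.2.1 Q
    · exact ih (by omega)
    · rw [Bool.and_eq_true] at h
      exact cond_good _ (Nat.le_of_ble_eq_true h.1) (Nat.blt_eq ▸ h.2)

end WeightedCounting

namespace WeightedCounting

open Turing Function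

variable {M : FinTM2} {α β γ : Type} [Data α] [Data β] [Data γ]

/-! ### Calling the subroutine -/

theorem initList_stk (s : List (M.Γ M.k₀)) :
    (initList M s).stk = update (fun _ => []) M.k₀ s := by
  funext k
  by_cases h : k = M.k₀
  · subst h; simp [initList]
  · simp [initList, h]

theorem haltList_stk (s : List (M.Γ M.k₁)) :
    (haltList M s).stk = update (fun _ => []) M.k₁ s := by
  funext k
  by_cases h : k = M.k₁
  · subst h; simp [haltList]
  · simp [haltList, h]

/-- The number of symbols a statement can push. -/
def pushCount {K Λ σ : Type} {Γ : K → Type} : TM2.Stmt Γ Λ σ → ℕ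
  | .push _ _ q => pushCount q + 1
  | .peek _ _ q => pushCount q
  | .pop _ _ q => pushCount q
  | .load _ q => pushCount q
  | .branch _ q₁ q₂ => pushCount q₁ + pushCount q₂
  | .goto _ => 0
  | .halt => 0

theorem stepAux_length_le {K Λ σ : Type} [DecidableEq K] {Γ : K → Type} (q : TM2.Stmt Γ Λ σ) (v : σ)
    (S : ∀ k, List (Γ k)) (k : K) :
    ((TM2.stepAux q v S).stk k).length ≤ (S k).length + pushCount q := by
  induction q generalizing v S with
  | push k' f q ih =>
    refine (ih _ _).trans ?_
    by_cases h : k = k'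
    · subst h; simp [pushCount]; omega
    · simp [pushCount, h]
  | peek k' f q ih => exact ih _ _
  | pop k' f q ih =>
    refine (ih _ _).trans ?_
    by_cases h : k = k'
    · subst h; simp [pushCount]
    · simp [pushCount, h]
  | load f q ih => exact ih _ _
  | branch f q₁ q₂ ih₁ ih₂ =>
    rw [TM2.stepAux, pushCount]
    cases f v
    · exact (ih₂ _ _).trans (by omega)
    · exact (ih₁ _ _).trans (by omega)
  | goto f => simp [pushCount]
  | halt => simp [pushCount]

variable (M) in
-- There are finitely many labels, so a step pushes a bounded number of symbols. A time bound thus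
-- yields the bound on the output length that `PT` requires.
theorem exists_length_le : ∃ c : ℕ, ∀ (n : ℕ) (x y : M.Cfg), Runs M.step n x y →
    ∀ k, (y.stk k).length ≤ (x.stk k).length + n * c := by
  have := M.ΛFin
  refine ⟨Finset.univ.sup fun l => pushCount (M.m l), fun n => ?_⟩
  induction n with
  | zero =>
    intro x y h k
    cases h
    simp
  | succ n ih =>
    intro x y h k
    obtain ⟨z, h₁, h₂⟩ := h.cases_succ
    refine (ih z y h₂ k).trans ?_
    obtain ⟨_ | l, v, S⟩ := x
    · cases h₁
    · cases h₁
      have h1 := stepAux_length_le (M.m l) v S k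
      have h2 : pushCount (M.m l) ≤ Finset.univ.sup fun l => pushCount (M.m l) :=
        Finset.le_sup (f := fun l => pushCount (M.m l)) (Finset.mem_univ l)
      rw [add_mul]
      dsimp only at h1 ⊢
      omega

/-- Pass three items to the subroutine, call it and fetch its output. -/
def callTriple (inp : M.Γ M.k₀ ≃ Option Bool) (out : M.Γ M.k₁ ≃ Bool) : Prog M :=
  .seq (.seq (.seq (.seq mvAB mvAB) mvAB)
    (.seq (.seq (transfer (.inl .B) id (.inr M.k₀) fun _ => inp.symm (some true))
        (.push (.inr M.k₀) (inp.symm none)))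
      (.seq (.seq (transfer (.inl .B) id (.inr M.k₀) fun b => inp.symm (some b))
        (.push (.inr M.k₀) (inp.symm none)))
        (transfer (.inl .B) id (.inr M.k₀) fun b => inp.symm (some b)))))
    (.seq .call (.seq (.seq (.push (.inl .B) none)
      (transfer (.inr M.k₁) (fun s => some (out s)) (.inl .B) some)) mvBA))

theorem execLE_transfer_sub (a b c : List (Option Bool)) (s : List (M.Γ M.k₀)) (l : List Bool)
    (ψ : Bool → M.Γ M.k₀) :
    ExecLE (transfer (.inl .B) id (.inr M.k₀) ψ)
      (mk a (item l ++ b) c [] [] (update (fun _ => []) M.k₀ s))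
      (mk a b c [] [] (update (fun _ => []) M.k₀ (l.reverse.map ψ ++ s))) (2 * l.length + 1) := by
  refine (execLE_transfer (M := M) (k := .inl .B) (k' := .inr M.k₀) (by simp) (φ := id) (e := some)
    (fun _ => rfl) ψ l (r := none :: b) rfl
    (mk a (item l ++ b) c [] [] (update (fun _ => []) M.k₀ s)) (by simp [item])).congr rfl ?_ le_rfl
  simp

theorem execLE_push_sub (a b c : List (Option Bool)) (s : List (M.Γ M.k₀)) (y : M.Γ M.k₀) :
    ExecLE (.push (.inr M.k₀) y) (mk a b c [] [] (update (fun _ => []) M.k₀ s))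
      (mk a b c [] [] (update (fun _ => []) M.k₀ (y :: s))) 1 := by
  refine (ExecLE.push (.inr M.k₀) y
    (mk a b c [] [] (update (fun _ => []) M.k₀ s))).congr rfl ?_ le_rfl
  simp

/-- The number is passed as the length of `l`: all its bits are sent as `true`, in accordance with
`encodeTriple`. The detour through `B` makes the last item go first, so that `x` ends up on top of
the input stack. -/
theorem execLE_callTriple (inp : M.Γ M.k₀ ≃ Option Bool) (out : M.Γ M.k₁ ≃ Bool)
    (x u l z : List Bool) (a b c : List (Option Bool)) {T : ℕ}
    (h : ∃ t ≤ T, Runs M.step t (initList M ((encodeTriple (x, u, l.length)).map inp.symm))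
      (haltList M (z.map out.symm))) :
    ExecLE (callTriple inp out) (st (item x ++ (item u ++ (item l ++ a))) b c)
      (st (item z ++ a) b c)
      (10 * (x.length + u.length + l.length + z.length + 3) + T) := by
  obtain ⟨t, ht, h⟩ := h
  have h1 := execLE_mvAB (M := M) x (item u ++ (item l ++ a)) b c [] [] (fun _ => [])
  have h2 := execLE_mvAB (M := M) u (item l ++ a) (item x.reverse ++ b) c [] [] (fun _ => [])
  have h3 := execLE_mvAB (M := M) l a (item u.reverse ++ (item x.reverse ++ b)) c [] [] (fun _ => [])
  have h4 := execLE_transfer_sub (M := M) a (item u.reverse ++ (item x.reverse ++ b)) c []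
    l.reverse (fun _ => inp.symm (some true))
  have h5 := execLE_push_sub (M := M) a (item u.reverse ++ (item x.reverse ++ b)) c
    (l.reverse.reverse.map (fun _ => inp.symm (some true)) ++ []) (inp.symm none)
  have h6 := execLE_transfer_sub (M := M) a (item x.reverse ++ b) c
    (inp.symm none :: (l.reverse.reverse.map (fun _ => inp.symm (some true)) ++ []))
    u.reverse (fun b => inp.symm (some b))
  have h7 := execLE_push_sub (M := M) a (item x.reverse ++ b) c
    (u.reverse.reverse.map (fun b => inp.symm (some b)) ++ (inp.symm none ::
      (l.reverse.reverse.map (fun _ => inp.symm (some true)) ++ []))) (inp.symm none)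
  have h8 := execLE_transfer_sub (M := M) a b c
    (inp.symm none :: (u.reverse.reverse.map (fun b => inp.symm (some b)) ++ (inp.symm none ::
      (l.reverse.reverse.map (fun _ => inp.symm (some true)) ++ []))))
    x.reverse (fun b => inp.symm (some b))
  have h9 : ExecLE .call _ _ T := ⟨t, ht, .call (mk a b c [] [] fun _ => []) h⟩
  rw [setSub_mk, setSub_mk, initList_stk, haltList_stk] at h9
  have e0 : update (fun _ => []) M.k₀ [] = fun k => ([] : List (M.Γ k)) := update_eq_self M.k₀ _
  have e1 : update (fun _ => []) M.k₁ [] = fun k => ([] : List (M.Γ k)) := update_eq_self M.k₁ _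
  rw [e0] at h4
  have h10 := ExecLE.push (.inl .B) none
    (mk (M := M) a b c [] [] (update (fun _ => []) M.k₁ (z.map out.symm)))
  have h11 := execLE_transfer (M := M) (k := .inr M.k₁) (k' := .inl .B) (by simp)
    (φ := fun s => some (out s)) (e := out.symm) (fun _ => by simp) some z (r := []) rfl
    (mk a (none :: b) c [] [] (update (fun _ => []) M.k₁ (z.map out.symm))) (by simp)
  have h12 := execLE_mvBA (M := M) z.reverse a b c [] [] (fun _ => [])
  simp only [update_mk_B, update_mk_inr, mk_B, update_idem, List.tail_nil] at h10 h11
  rw [e1] at h11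
  have e2 : (encodeTriple (x, u, l.length)).map inp.symm =
      x.reverse.reverse.map (fun b => inp.symm (some b)) ++
      (inp.symm none :: (u.reverse.reverse.map (fun b => inp.symm (some b)) ++ (inp.symm none ::
      (l.reverse.reverse.map (fun _ => inp.symm (some true)) ++ [])))) := by
    simp [encodeTriple, List.map_const', Function.comp_def]
  rw [e2] at h9
  have e3 : z.reverse.map some ++ none :: b = item z.reverse ++ b := by simp [item]
  rw [e3] at h11
  refine ((((h1.seq h2).seq h3).seq ((h4.seq h5).seq ((h6.seq h7).seq h8))).seq
    (h9.seq ((h10.seq h11).seq h12))).congr rfl (by simp) ?_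
  simp only [length_item, List.length_reverse]
  omega

/-- A function computed by a machine in polynomial time is computed by a program that calls the
machine. -/
theorem PT.of_polyTime {v : List Bool × List Bool × ℕ → ℤ}
    (hv : TM2ComputableInPolyTime encodeTriple encodeInt v) :
    PT hv.tm fun a : List Bool × List Bool × List Bool =>
      encodeInt (v (a.1, a.2.1, a.2.2.length)) := by
  obtain ⟨κ, hκ⟩ := exists_length_le hv.tm
  have hsize : ∀ a : List Bool × List Bool × List Bool,
      (encodeTriple (a.1, a.2.1, a.2.2.length)).length + 1 = size a := by
    intro a
    simp [encodeTriple]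
    omega
  have hrun : ∀ a : List Bool × List Bool × List Bool, ∃ t ≤ hv.time.eval (size a),
      Runs hv.tm.step t
        (initList hv.tm ((encodeTriple (a.1, a.2.1, a.2.2.length)).map hv.inputAlphabet.symm))
        (haltList hv.tm ((encodeInt (v (a.1, a.2.1, a.2.2.length))).map hv.outputAlphabet.symm)) := by
    intro a
    have h := hv.outputsFun (a.1, a.2.1, a.2.2.length)
    exact ⟨h.steps, h.steps_le_m.trans (eval_mono _ (by have := hsize a; omega)), h.evals_in_steps⟩
  have hlen : ∀ a : List Bool × List Bool × List Bool,
      (encodeInt (v (a.1, a.2.1, a.2.2.length))).length ≤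
        size a + hv.time.eval (size a) * κ := by
    intro a
    obtain ⟨t, ht, h⟩ := hrun a
    have h1 := hκ _ _ _ h hv.tm.k₁
    rw [initList_stk, haltList_stk, update_self, List.length_map] at h1
    have h2 : (update (fun _ => []) hv.tm.k₀ ((encodeTriple (a.1, a.2.1, a.2.2.length)).map
        hv.inputAlphabet.symm) hv.tm.k₁).length ≤ size a := by
      have h3 := hsize a
      generalize hw : (encodeTriple (a.1, a.2.1, a.2.2.length)).map hv.inputAlphabet.symm = w
      have h4 : w.length + 1 = size a := by rw [← hw, List.length_map, h3]
      generalize hv.tm.k₁ = k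
      by_cases hk : k = hv.tm.k₀
      · subst hk; rw [update_self]; omega
      · rw [update_of_ne hk]; simp
    have h3 : t * κ ≤ hv.time.eval (size a) * κ := Nat.mul_le_mul_right _ ht
    omega
  refine ⟨callTriple hv.inputAlphabet hv.outputAlphabet,
    30 * Polynomial.X + 10 * (hv.time * Polynomial.C κ) + hv.time + 2, fun a => ⟨?_, fun r b c => ?_⟩⟩
  · have := hlen a
    rw [size_list]
    simp only [Polynomial.eval_add, Polynomial.eval_mul, Polynomial.eval_ofNat, Polynomial.eval_X,
      Polynomial.eval_C]
    omega
  · have h := execLE_callTriple hv.inputAlphabet hv.outputAlphabet a.1 a.2.1 a.2.2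
      (encodeInt (v (a.1, a.2.1, a.2.2.length))) r b c (hrun a)
    have h1 := hlen a
    refine h.congr (by simp [enc_prod, enc_list]) (by rw [enc_list]) ?_
    simp only [size_prod, size_list, Polynomial.eval_add, Polynomial.eval_mul,
      Polynomial.eval_ofNat, Polynomial.eval_X, Polynomial.eval_C] at h1 ⊢
    omega

/-! ### From programs to machines -/

/-- The machine that executes `p`, with input on the stack `A` and output on the stack `Q`. -/
def toMachine (p : Prog M) : FinTM2 where
  K := Idx M
  kFin := letI := M.kFin; inferInstance
  k₀ := .inl .A
  k₁ := .inl .Q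
  Γ := Sym M
  Λ := Option (Lab p)
  main := some (entry p)
  σ := Var M
  initialState := (M.initialState, none)
  σFin := letI := M.σFin; inferInstance
  Γk₀Fin := inferInstanceAs (Fintype (Option Bool))
  -- The configuration `haltList` prescribes the initial internal state, so it is restored before
  -- halting.
  m l := l.elim (.load (fun _ => (M.initialState, none)) .halt) (code p some none)

theorem toMachine_runs {p : Prog M} {a : List (Option Bool)} {q : List Bool} {T : ℕ}
    (h : ExecLE p (st a [] []) (mk [] [] [] q [] fun _ => []) T) :
    ∃ t ≤ T + 1, Runs (toMachine p).step t (initList (toMachine p) a) (haltList (toMachine p) q) := by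
  obtain ⟨t, ht, h⟩ := h
  obtain ⟨w, hw⟩ := h.runs (st := (toMachine p).step) (ι := fun c => c) (em := some) (ex := none)
    (fun l v S => rfl) none
  refine ⟨t + 1, by omega, ?_⟩
  have e0 : initList (toMachine p) a = ⟨some (some (entry p)), (M.initialState, none), st a [] []⟩ := by
    refine congrArg (TM2.Cfg.mk _ _) ?_
    refine (initList_stk (M := toMachine p) a).trans ?_
    funext k
    rcases k with (_ | _ | _ | _ | _) | k <;> rfl
  have e1 : haltList (toMachine p) q = ⟨none, (M.initialState, none), mk [] [] [] q [] fun _ => []⟩ := by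
    refine congrArg (TM2.Cfg.mk _ _) ?_
    refine (haltList_stk (M := toMachine p) q).trans ?_
    funext k
    rcases k with (_ | _ | _ | _ | _) | k <;> rfl
  rw [e0, e1]
  exact hw.trans (Runs.single rfl)

/-- Convert the encoding of a pair to two items. -/
def readPair : Prog M :=
  .seq (.seq mvAB (transfer (.inl .A) id (.inl .C) some))
    (.seq (.seq (.push (.inl .A) none) (transfer (.inl .C) id (.inl .A) some)) mvBA)

theorem execLE_readPair (x u : List Bool) :
    ExecLE (M := M) readPair (st (encodePair (x, u)) [] []) (st (item x ++ item u) [] [])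
      (10 * (x.length + u.length + 1)) := by
  have h1 := execLE_mvAB (M := M) x (u.map some) [] [] [] [] (fun _ => [])
  have h2 := execLE_transfer (M := M) (k := .inl .A) (k' := .inl .C) (by simp) (φ := id) (e := some)
    (fun _ => rfl) some u (r := []) rfl (st (u.map some) (item x.reverse ++ []) []) (by simp)
  have h3 := ExecLE.push (.inl .A) none (st (M := M) [] (item x.reverse ++ [])
    (u.reverse.map some ++ []))
  have h4 := execLE_transfer (M := M) (k := .inl .C) (k' := .inl .A) (by simp) (φ := id) (e := some)
    (fun _ => rfl) some u.reverse (r := []) rfl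
    (st [none] (item x.reverse ++ []) (u.reverse.map some ++ [])) (by simp)
  have h5 := execLE_mvBA (M := M) x.reverse (item u) [] [] [] [] (fun _ => [])
  simp only [update_mk_A, update_mk_C, mk_A, mk_C, List.tail_nil, List.reverse_reverse] at h2 h3 h4 h5
  refine ((h1.seq h2).seq ((h3.seq h4).seq h5)).congr ?_ rfl ?_
  · simp [encodePair, item]
  · simp only [length_item, List.length_reverse]
    omega

/-- Move a bit from an item on `A` to the stack `Q`. -/
def writeBool : Prog M :=
  .seq (.case (.inl .A) id (.push (.inl .Q) true) (.push (.inl .Q) false) skip) popA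

theorem execLE_writeBool (b : Bool) :
    ExecLE (M := M) writeBool (st (item [b]) [] []) (mk [] [] [] [b] [] fun _ => []) 3 := by
  have h1 : ExecLE (M := M)
      (.case (.inl .A) id (.push (.inl .Q) true) (.push (.inl .Q) false) skip)
      (st (item [b]) [] []) (mk [none] [] [] [b] [] fun _ => []) 2 := by
    refine ExecLE.case_some b rfl (T := 1) ?_
    have h := ExecLE.push (.inl .Q) b (st (M := M) [none] [] [])
    cases b <;> exact h.congr (by simp [item]) (by simp) le_rfl
  exact h1.seq (execLE_popA _ _ _ _ _ _ _)

/-- Predicates computed by programs are polynomial-time predicates. -/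
theorem PT.polyTime {T : List Bool × List Bool → Bool} (hT : PT M T) :
    PolyTime encodePair Computability.encodeBool T := by
  obtain ⟨p, P, hp⟩ := hT
  have h : ∀ a : List Bool × List Bool, ∃ t ≤ (10 * Polynomial.X + P.comp (Polynomial.X + 1) + 4 :
      Polynomial ℕ).eval (encodePair a).length,
      Runs (toMachine (.seq (.seq readPair p) writeBool)).step t
        (initList (toMachine (.seq (.seq readPair p) writeBool)) (encodePair a))
        (haltList (toMachine (.seq (.seq readPair p) writeBool)) [T a]) := by
    intro ⟨x, u⟩
    have h1 := execLE_readPair (M := M) x u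
    have h2 := (hp (x, u)).2 [] [] []
    have h3 := execLE_writeBool (M := M) (T (x, u))
    rw [enc_prod, enc_list, enc_list, enc_bool, List.append_nil, List.append_nil] at h2
    obtain ⟨t, ht, h⟩ := toMachine_runs ((h1.seq h2).seq h3)
    refine ⟨t, ht.trans ?_, h⟩
    have e1 : (encodePair (x, u)).length = x.length + u.length + 1 := by simp [encodePair]; omega
    have e2 : size (x, u) = (encodePair (x, u)).length + 1 := by rw [e1]; simp; omega
    simp only [e2, Polynomial.eval_add, Polynomial.eval_mul, Polynomial.eval_comp,
      Polynomial.eval_ofNat, Polynomial.eval_X, Polynomial.eval_one]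
    omega
  choose t ht h using h
  exact ⟨{
    tm := toMachine (.seq (.seq readPair p) writeBool)
    inputAlphabet := Equiv.refl (Option Bool)
    outputAlphabet := Equiv.refl Bool
    time := 10 * Polynomial.X + P.comp (Polynomial.X + 1) + 4
    outputsFun := fun a =>
      { steps := t a
        evals_in_steps :=
          (congrArg (fun l => (flip bind (toMachine (.seq (.seq readPair p) writeBool)).step)^[t a]
            (some (initList (toMachine (.seq (.seq readPair p) writeBool)) l)))
            (List.map_id (encodePair a))).trans (h a)
        steps_le_m := ht a } }⟩

/-! ### Machines with one oracle call -/

/-- The oracle machine that executes `p`, calls the oracle and executes `q`; the input is on the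
stack `Q`, which is also the query tape, and the output is on the stack `A`. -/
def toOracle (p q : Prog M) : OracleTM Bool (Option Bool) where
  tm :=
    { K := Idx M
      kFin := letI := M.kFin; inferInstance
      k₀ := .inl .Q
      k₁ := .inl .A
      Γ := Sym M
      Λ := Lab p ⊕ Lab q ⊕ Bool
      main := .inl (entry p)
      σ := Var M
      initialState := (M.initialState, none)
      σFin := letI := M.σFin; inferInstance
      Γk₀Fin := inferInstanceAs (Fintype Bool)
      -- The program `p` exits into the query label, whose own statement is never executed; `q`
      -- exits into the label that restores the internal state and halts.
      m := Sum.elim (code p Sum.inl (.inr (.inr true)))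
        (Sum.elim (code q (fun l => .inr (.inl l)) (.inr (.inr false)))
          fun _ => .load (fun _ => (M.initialState, none)) .halt) }
  inputAlphabet := Equiv.refl Bool
  outputAlphabet := Equiv.refl (Option Bool)
  kq := .inl .Q
  ka := .inl .R
  queryAlphabet := Equiv.refl Bool
  answerAlphabet := Equiv.refl Bool
  queryLabel := .inr (.inr true)
  answerLabel := .inr (.inl (entry q))

theorem toOracle_runs {p q : Prog M} (O : List Bool → List Bool) {x : List Bool}
    {a b : List (Option Bool)} {T T' : ℕ}
    (hp : ExecLE p (mk [] [] [] x [] fun _ => []) (mk a [] [] x [] fun _ => []) T)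
    (hq : ExecLE q (mk a [] [] [] (O x) fun _ => []) (st b [] []) T') :
    ∃ t ≤ T + T' + 2, Runs ((toOracle p q).step O) t (initList (toOracle p q).tm x, 0)
      (haltList (toOracle p q).tm b, 1) := by
  obtain ⟨t, ht, hp⟩ := hp
  obtain ⟨t', ht', hq⟩ := hq
  obtain ⟨w, hw⟩ := hp.runs (Λ := Lab p ⊕ Lab q ⊕ Bool) (st := (toOracle p q).step O)
    (ι := fun c => (c, 0)) (em := Sum.inl)
    (ex := .inr (.inr true)) (fun l v S => by
      rw [OracleTM.step, if_neg (fun h => by cases h)]; rfl) none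
  obtain ⟨w', hw'⟩ := hq.runs (Λ := Lab p ⊕ Lab q ⊕ Bool) (st := (toOracle p q).step O)
    (ι := fun c => (c, 1)) (em := fun l => .inr (.inl l))
    (ex := .inr (.inr false)) (fun l v S => by
      rw [OracleTM.step, if_neg (fun h => by cases h)]; rfl) w
  refine ⟨t + (1 + (t' + 1)), by omega, ?_⟩
  have e0 : initList (toOracle p q).tm x =
      ⟨some (Sum.inl (entry p)), (M.initialState, none), mk [] [] [] x [] fun _ => []⟩ := by
    refine congrArg (TM2.Cfg.mk _ _) ?_
    refine (initList_stk (M := (toOracle p q).tm) x).trans ?_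
    funext k
    rcases k with (_ | _ | _ | _ | _) | k <;> rfl
  have e1 : haltList (toOracle p q).tm b = ⟨none, (M.initialState, none), st b [] []⟩ := by
    refine congrArg (TM2.Cfg.mk _ _) ?_
    refine (haltList_stk (M := (toOracle p q).tm) b).trans ?_
    funext k
    rcases k with (_ | _ | _ | _ | _) | k <;> rfl
  rw [e0, e1]
  refine hw.trans (.trans (.single ?_) (hw'.trans (.single ?_)))
  · refine (if_pos rfl).trans ?_
    refine congrArg (fun s => some ((⟨some (.inr (.inl (entry q))), (M.initialState, w), s⟩ :
      TM2.Cfg (Sym M) (Lab p ⊕ Lab q ⊕ Bool) (Var M)), 1)) ?_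
    have h : (update (update (mk a [] [] x [] fun _ => []) (.inl .Q) []) (.inl .R)
      ((O (x.map id)).map id) : Store M) = mk a [] [] [] (O x) fun _ => [] := by simp
    exact h
  · exact if_neg fun h => by cases h

/-- Copy the input to the stack `A`. -/
def readInput : Prog M :=
  .seq (.seq (.seq (.push (.inl .B) none) (transfer (.inl .Q) some (.inl .B) some)) mvBA)
    (.seq (dup 1) (.seq mvAB (transfer (.inl .B) id (.inl .Q) fun b => b)))

/-- The oracle is asked about `x` itself, so the input has to stay on the query tape while a copy is
kept for later. -/
theorem execLE_readInput (x : List Bool) :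
    ExecLE (M := M) readInput (mk [] [] [] x [] fun _ => []) (mk (item x) [] [] x [] fun _ => [])
      (20 * x.length + 30) := by
  have h1 := ExecLE.push (.inl .B) none (mk (M := M) [] [] [] x [] fun _ => [])
  have h2 := execLE_transfer (M := M) (k := .inl .Q) (k' := .inl .B) (by simp) (φ := some)
    (e := fun b => b) (fun _ => rfl) some x (r := []) rfl (mk [] [none] [] x [] fun _ => []) (by simp)
  have h3 := execLE_mvBA (M := M) x.reverse [] [] [] [] [] (fun _ => [])
  have h4 := execLE_dup (M := M) [] [] [] [] [] (fun _ => []) [x]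
  have h5 := execLE_mvAB (M := M) x (item x) [] [] [] [] (fun _ => [])
  have h6 := execLE_transfer (M := M) (k := .inl .B) (k' := .inl .Q) (by simp) (φ := id)
    (e := some) (fun _ => rfl) (fun b => b) x.reverse (r := [none]) rfl
    (mk (item x) (item x.reverse) [] [] [] fun _ => []) (by simp [item])
  have e : encItems [x] = item x := by simp [encItems]
  have e' : x.reverse.map some ++ [none] = item x.reverse ++ [] := by simp [item]
  simp only [update_mk_B, update_mk_Q, mk_B, mk_Q, List.tail_nil, List.tail_cons,
    List.reverse_reverse, e, e', List.append_nil, List.map_id', List.length_singleton] at *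
  refine (((h1.seq h2).seq h3).seq (h4.seq (h5.seq h6))).mono ?_
  simp only [length_item, List.length_reverse]
  omega

/-- Move the answer of the oracle to the stack `A`. -/
def readAnswer : Prog M :=
  .seq (.seq (.push (.inl .B) none) (transfer (.inl .R) some (.inl .B) some)) mvBA

theorem execLE_readAnswer (y : List Bool) (a : List (Option Bool)) :
    ExecLE (M := M) readAnswer (mk a [] [] [] y fun _ => []) (st (item y ++ a) [] [])
      (4 * y.length + 4) := by
  have h1 := ExecLE.push (.inl .B) none (mk (M := M) a [] [] [] y fun _ => [])
  have h2 := execLE_transfer (M := M) (k := .inl .R) (k' := .inl .B) (by simp) (φ := some)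
    (e := fun b => b) (fun _ => rfl) some y (r := []) rfl (mk a [none] [] [] y fun _ => []) (by simp)
  have h3 := execLE_mvBA (M := M) y.reverse a [] [] [] [] (fun _ => [])
  have e' : y.reverse.map some ++ [none] = item y.reverse ++ [] := by simp [item]
  simp only [update_mk_B, update_mk_R, mk_B, List.tail_nil,
    List.reverse_reverse, e'] at *
  refine ((h1.seq h2).seq h3).mono ?_
  simp only [length_item, List.length_reverse]
  omega

/-- Convert two items to a sequence with a separator. -/
def writePair : Prog M :=
  .seq (.seq mvAB (transfer (.inl .A) id (.inl .C) some))
    (.seq (transfer (.inl .C) id (.inl .A) some) mvBA)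

theorem execLE_writePair (x u : List Bool) :
    ExecLE (M := M) writePair (st (item x ++ item u) [] []) (st (x.map some ++ none :: u.map some) [] [])
      (10 * (x.length + u.length + 1)) := by
  have h1 := execLE_mvAB (M := M) x (item u) [] [] [] [] (fun _ => [])
  have h2 := execLE_transfer (M := M) (k := .inl .A) (k' := .inl .C) (by simp) (φ := id) (e := some)
    (fun _ => rfl) some u (r := [none]) rfl (st (item u) (item x.reverse ++ []) []) (by simp [item])
  have h4 := execLE_transfer (M := M) (k := .inl .C) (k' := .inl .A) (by simp) (φ := id) (e := some)
    (fun _ => rfl) some u.reverse (r := []) rfl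
    (st [] (item x.reverse ++ []) (u.reverse.map some ++ [])) (by simp)
  have h5 := execLE_mvBA (M := M) x.reverse (u.map some ++ []) [] [] [] [] (fun _ => [])
  simp only [update_mk_A, update_mk_C, mk_A, mk_C, List.tail_nil, List.tail_cons,
    List.reverse_reverse] at h2 h4 h5
  refine ((h1.seq h2).seq (h4.seq h5)).congr rfl ?_ ?_
  · simp [item]
  · simp only [length_item, List.length_reverse]
    omega

end WeightedCounting

namespace WeightedCounting

open Turing Function

variable {M : FinTM2}

/-- A fraction that is computed by a program from the value of a `#P` function is computed with one
oracle call. -/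
theorem PT.fpSharpP {g : List Bool → ℕ} (hg : g ∈ SharpP) {r : List Bool → ℚ}
    {F : ℕ × List Bool → List Bool × List Bool} (hF : PT M F)
    (h : ∀ x, F (g x, x) = (encodeInt (r x).num, (r x).den.bits)) : r ∈ FPSharpP 1 encodeRat := by
  obtain ⟨p, P, hp⟩ := hF
  obtain ⟨pg, T, -, hT⟩ := id hg
  -- A count of strings of polynomial length has polynomially many digits, so the answer can be read
  -- in polynomial time.
  have hle : ∀ x, g x ≤ 2 ^ pg.eval x.length := by
    intro x
    rw [hT]
    calc _ ≤ ∑ u : Fin (pg.eval x.length) → Bool, 1 := Finset.sum_le_sum fun u _ => Bool.toNat_le _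
      _ = _ := by simp
  have hsize : ∀ x, (g x).bits.length ≤ pg.eval x.length + 1 := by
    intro x
    have h1 : g x < 2 ^ (pg.eval x.length + 1) := by
      rw [pow_succ]
      have := hle x
      have : 0 < 2 ^ pg.eval x.length := by positivity
      omega
    have := size_nat_le h1
    rw [size_nat] at this
    omega
  refine ⟨g, hg, toOracle readInput (.seq (.seq readAnswer p) writePair), ?_⟩
  refine ⟨20 * Polynomial.X + 50 + 4 * pg +
    11 * P.comp (pg + Polynomial.X + 3), fun x => ⟨1, le_rfl, ?_⟩⟩
  have h1 := execLE_readInput (M := M) x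
  have h2 := execLE_readAnswer (M := M) (g x).bits (item x)
  have h3 := (hp (g x, x)).2 [] [] []
  have h4 := execLE_writePair (M := M) (encodeInt (r x).num) (r x).den.bits
  have h5 := (hp (g x, x)).1
  have h6 : size (g x, x) ≤ pg.eval x.length + x.length + 3 := by
    have := hsize x
    rw [size_prod, size_nat, size_list]
    dsimp only
    omega
  have h7 := eval_mono P h6
  rw [h] at h3 h5
  rw [enc_prod, enc_prod, enc_nat, enc_list, enc_list, enc_list, List.append_nil,
    List.append_nil] at h3
  obtain ⟨t, ht, hrun⟩ := toOracle_runs (fun y => (g y).bits) h1 ((h2.seq h3).seq h4)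
  refine ⟨⟨t, ?_⟩, ht.trans ?_⟩
  · have e1 : x.map (toOracle readInput
        (.seq (.seq readAnswer p) writePair)).inputAlphabet.symm = x := List.map_id x
    have e2 : (encodeRat (r x)).map (toOracle readInput
        (.seq (.seq readAnswer p) writePair)).outputAlphabet.symm = encodeRat (r x) :=
      List.map_id _
    rw [e1, e2]
    exact hrun
  · have := hsize x
    rw [size_prod, size_list, size_list] at h5
    dsimp only at h5
    simp only [Polynomial.eval_add, Polynomial.eval_mul, Polynomial.eval_comp,
      Polynomial.eval_ofNat, Polynomial.eval_X] at h7 ⊢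
    omega

/-! ### Counting -/

theorem sum_ofFn_add {δ : Type} [AddCommMonoid δ] (G : List Bool → δ) {k a b : ℕ} (h : k = a + b) :
    ∑ y : Fin k → Bool, G (List.ofFn y) =
      ∑ u : Fin a → Bool, ∑ t : Fin b → Bool, G (List.ofFn u ++ List.ofFn t) := by
  subst h
  rw [← Fintype.sum_prod_type', ← (Fin.appendEquiv a b).sum_comp]
  refine Finset.sum_congr rfl fun y _ => ?_
  rw [← List.ofFn_fin_append]
  rfl

/-- This turns a number into a count of strings. Splitting off the lowest digit, `2t + 1 < m` means
`t < m / 2` and `2t < m` means `t < (m + 1) / 2`; the two counts add up. -/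
theorem sum_ofBits_lt (k m : ℕ) :
    ∑ t : Fin k → Bool, (Nat.blt (ofBits (List.ofFn t)) m).toNat = min m (2 ^ k) := by
  induction k generalizing m with
  | zero =>
    rcases Nat.eq_zero_or_pos m with rfl | hm
    · have : Nat.blt 0 0 = false := rfl
      simp [this]
    · have : Nat.blt 0 m = true := by simpa using hm
      simp [this]
      omega
  | succ k ih =>
    rw [← (Fin.consEquiv fun _ => Bool).sum_comp, Fintype.sum_prod_type, Fintype.sum_bool]
    have hcons : ∀ (b : Bool) (t : Fin k → Bool),
        List.ofFn (Fin.consEquiv (fun _ => Bool) (b, t)) = b :: List.ofFn t := by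
      intro b t
      simp [Fin.consEquiv, List.ofFn_succ]
    have e1 : ∀ t : Fin k → Bool,
        Nat.blt (ofBits (List.ofFn (Fin.consEquiv (fun _ => Bool) (true, t)))) m =
          Nat.blt (ofBits (List.ofFn t)) (m / 2) := by
      intro t
      rw [Bool.eq_iff_iff, Nat.blt_eq, Nat.blt_eq]
      rw [hcons, ofBits_cons, Bool.toNat_true]
      omega
    have e0 : ∀ t : Fin k → Bool,
        Nat.blt (ofBits (List.ofFn (Fin.consEquiv (fun _ => Bool) (false, t)))) m =
          Nat.blt (ofBits (List.ofFn t)) ((m + 1) / 2) := by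
      intro t
      rw [Bool.eq_iff_iff, Nat.blt_eq, Nat.blt_eq]
      rw [hcons, ofBits_cons, Bool.toNat_false]
      omega
    simp only [e0, e1]
    rw [ih, ih, pow_succ]
    generalize 2 ^ k = K
    omega

/-- The value of the shifted weights is in `#P`. -/
theorem sharpP_shift {v : List Bool × List Bool × ℕ → ℤ} (hv : PolyTime encodeTriple encodeInt v)
    (p B e : Polynomial ℕ) : ∃ d : Polynomial ℕ, ∃ g ∈ SharpP, ∀ x : List Bool,
      (g x : ℤ) = ∑ u : Fin (p.eval x.length) → Bool,
        (v (x, List.ofFn u, B.eval x.length) + 2 ^ (d + e).eval x.length) := by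
  obtain ⟨hv⟩ := hv
  have hV := PT.of_polyTime hv
  obtain ⟨P, hP⟩ := hV.size_le
  -- The argument is the size of the triple `(x, u, b)` with its three end markers, so `d` bounds
  -- the number of digits of `v`.
  let d := P.comp (Polynomial.X + p + B + 3)
  let s := d + e
  let z : List Bool × List Bool → List Bool := fun a =>
    encodeInt (v (a.1, a.2.take (p.eval a.1.length), B.eval a.1.length))
  -- The witness is `u` followed by `t`, accepted when `t < v + 2 ^ s`. For negative `v` the
  -- absolute value is moved to the other side, so that only natural numbers are compared.
  let T : List Bool × List Bool → Bool := fun a =>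
    bif (z a).headD false then
      Nat.blt (ofBits (a.2.drop (p.eval a.1.length)) + ofBits (z a).tail) (2 ^ s.eval a.1.length)
    else
      Nat.blt (ofBits (a.2.drop (p.eval a.1.length))) (2 ^ s.eval a.1.length + ofBits (z a).tail)
  have hlen : PT hv.tm fun a : List Bool × List Bool => unary a.1.length :=
    PT.unary_length.comp (by fun_prop)
  have hz : PT hv.tm z := by
    have h1 := PT.take (PT.unary_eval p hlen) (f := fun a : List Bool × List Bool => a.2)
      (by fun_prop)
    have h2 := PT.unary_eval B hlen
    have h3 := hV.comp (PT.prodMk (f := fun a : List Bool × List Bool => a.1) (by fun_prop)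
      (h1.prodMk h2))
    simpa only [length_unary] using h3
  have hT : PT hv.tm T := by
    have h1 := PT.drop (PT.unary_eval p hlen) (f := fun a : List Bool × List Bool => a.2)
      (by fun_prop)
    have h2 := PT.two_pow (PT.unary_eval s hlen)
    unfold T
    fun_prop
  refine ⟨d, fun x => ∑ u : Fin ((p + (s + 1)).eval x.length) → Bool, (T (x, List.ofFn u)).toNat,
    ⟨p + (s + 1), T, hT.polyTime, fun x => rfl⟩, fun x => ?_⟩
  change ((∑ u : Fin ((p + (s + 1)).eval x.length) → Bool, (T (x, List.ofFn u)).toNat : ℕ) : ℤ) = _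
  rw [sum_ofFn_add (fun y => (T (x, y)).toNat) (Polynomial.eval_add (p := p)), Nat.cast_sum]
  refine Finset.sum_congr rfl fun u _ => ?_
  have hzu : ∀ t : List Bool, z (x, List.ofFn u ++ t) =
      encodeInt (v (x, List.ofFn u, B.eval x.length)) := by
    intro t
    simp only [z]
    rw [List.take_left' (List.length_ofFn)]
  have hdrop : ∀ t : List Bool, (List.ofFn u ++ t).drop (p.eval x.length) = t :=
    fun t => List.drop_left' List.length_ofFn
  have hbound : (v (x, List.ofFn u, B.eval x.length)).natAbs < 2 ^ s.eval x.length := by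
    have h1 := hP (x, List.ofFn u, unary (B.eval x.length))
    simp only [size_prod, size_list, length_unary, List.length_ofFn, encodeInt,
      List.length_cons] at h1
    refine (lt_two_pow_bits _).trans_le (Nat.pow_le_pow_right (by norm_num) ?_)
    have h2 : d.eval x.length =
        P.eval (x.length + 1 + (p.eval x.length + 1 + (B.eval x.length + 1))) := by
      simp only [d, Polynomial.eval_comp, Polynomial.eval_add, Polynomial.eval_X,
        Polynomial.eval_ofNat]
      congr 1
      ring
    simp only [s, Polynomial.eval_add, h2]
    omega
  change _ = _ + 2 ^ s.eval x.length
  simp only [T, hzu, hdrop, encodeInt, List.headD_cons, List.tail_cons, ofBits_bits]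
  generalize v (x, List.ofFn u, B.eval x.length) = w at hbound
  -- From `|v| < 2 ^ s` it follows that `v + 2 ^ s < 2 ^ (s + 1)`, so strings `t` with one more bit
  -- suffice and the minimum in `sum_ofBits_lt` is never cut off.
  have hs : (s + 1).eval x.length = s.eval x.length + 1 := by simp
  rw [hs]
  generalize s.eval x.length = k at hbound
  have hk : 2 ^ (k + 1) = 2 * 2 ^ k := by ring
  have hk2 : (2 : ℤ) ^ k = ((2 ^ k : ℕ) : ℤ) := by push_cast; rfl
  rw [hk2]
  rcases lt_or_ge w 0 with hw | hw
  · have e : ∀ t : ℕ, Nat.blt (t + w.natAbs) (2 ^ k) = Nat.blt t (2 ^ k - w.natAbs) := by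
      intro t
      rw [Bool.eq_iff_iff, Nat.blt_eq, Nat.blt_eq]
      omega
    simp only [decide_eq_true hw, cond_true, e, sum_ofBits_lt, hk]
    generalize (2 : ℕ) ^ k = K at hbound
    rw [min_eq_left (by omega)]
    omega
  · simp only [decide_eq_false (not_lt.2 hw), cond_false, sum_ofBits_lt, hk]
    generalize (2 : ℕ) ^ k = K at hbound
    rw [min_eq_left (by omega)]
    omega

theorem encodeRat_bounds {r : ℚ} {n : ℕ} (h : (encodeRat r).length ≤ n) : r.den < 2 ^ n := by
  refine (lt_two_pow_bits _).trans_le (Nat.pow_le_pow_right (by norm_num) ?_)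
  simp [encodeRat] at h
  omega

theorem add_natCast_num_den (r : ℚ) (m : ℕ) :
    (r + m).den = r.den ∧ (r + m).num = r.num + m * r.den := by
  have hd : (0 : ℤ) < r.den := by exact_mod_cast r.pos
  have h : r + m = ((r.num + m * r.den : ℤ) : ℚ) / ((r.den : ℤ) : ℚ) := by
    have h0 : (r.den : ℚ) ≠ 0 := by exact_mod_cast r.den_nz
    nth_rw 1 [← Rat.num_div_den r]
    push_cast
    field_simp
  have hc : (r.num + m * r.den).natAbs.Coprime (r.den : ℤ).natAbs := by
    rw [← Int.isCoprime_iff_nat_coprime]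
    exact (Rat.isCoprime_num_den r).add_mul_right_left _
  rw [h]
  exact ⟨by exact_mod_cast Rat.den_div_eq_of_coprime hd hc, Rat.num_div_eq_of_coprime hd hc⟩

end WeightedCounting

/-! ### Recovering the weighted sum from one query -/

open WeightedCounting in
theorem mainTheorem3 (f : List Bool → ℝ) (hf : f ∈ WeightedCounting.SharpPWeighted Set.univ)
    (q : Polynomial ℕ)
    (hq : ∀ x, ∃ r : ℚ, f x = (r : ℝ) ∧
      (WeightedCounting.encodeRat r).length ≤ q.eval x.length) :
    ∃ r : List Bool → ℚ, (∀ x, f x = (r x : ℝ)) ∧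
      r ∈ WeightedCounting.FPSharpP 1 WeightedCounting.encodeRat := by
  choose r hr hlen using hq
  refine ⟨r, hr, ?_⟩
  obtain ⟨p, w, ⟨v, hv, hw⟩, -, hf⟩ := hf
  -- This gives `2 ^ B = 4 * 2 ^ p * (2 ^ q) ^ 2`, the precision that `search_eq` needs with `X = 2
  -- ^ p` and `Q = 2 ^ q`.
  let B : Polynomial ℕ := p + 2 * q + 2
  -- The additional exponent `B` makes the shift divisible by `2 ^ B`, so that `f x` is shifted by
  -- the integer `2 ^ (p + d)`.
  obtain ⟨d, g, hg, hgv⟩ := sharpP_shift hv p B B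
  let F : ℕ × List Bool → List Bool × List Bool := fun a =>
    let n := a.2.length
    let s := search (2 ^ p.eval n) (2 ^ q.eval n) a.1 (2 ^ B.eval n)
    let m := 2 ^ (p + d).eval n * s.2
    -- One of the truncated differences is zero, so their sum is `|s.1 - m|`.
    (Nat.blt s.1 m :: ((s.1 - m) + (m - s.1)).bits, s.2.bits)
  -- After the query no subroutine is needed; any machine serves as the parameter.
  have hF : PT (Turing.idComputer Bool) F := by
    have hn : PT (Turing.idComputer Bool) fun a : ℕ × List Bool => unary a.2.length :=
      PT.unary_length.comp (by fun_prop)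
    have hs := PT.search (PT.two_pow (PT.unary_eval p hn)) (PT.two_pow (PT.unary_eval q hn))
      (N := fun a : ℕ × List Bool => a.1) (by fun_prop) (PT.two_pow (PT.unary_eval B hn))
    have hm := (PT.two_pow (PT.unary_eval (p + d) hn)).mul hs.snd
    exact ((hs.fst.blt hm).cons_var ((hs.fst.sub hm).add (hm.sub hs.fst)).bits).prodMk hs.snd.bits
  refine PT.fpSharpP hg hF fun x => ?_
  let c := (p + d).eval x.length
  have hB : B.eval x.length = p.eval x.length + 2 * q.eval x.length + 2 := by simp [B]
  have hden := encodeRat_bounds (hlen x)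
  obtain ⟨hden', hnum'⟩ := add_natCast_num_den (r x) (2 ^ c)
  -- Each of the `2 ^ p` summands contributes an error of at most `1 / 2 ^ B`.
  have happrox : |(g x : ℝ) / (2 ^ B.eval x.length : ℕ) - (r x + (2 ^ c : ℕ) : ℚ)| ≤
      ((2 ^ p.eval x.length : ℕ) : ℝ) / (2 ^ B.eval x.length : ℕ) := by
    have h1 : (g x : ℝ) = ∑ u : Fin (p.eval x.length) → Bool,
        (v (x, List.ofFn u, B.eval x.length) : ℝ) + 2 ^ p.eval x.length *
          2 ^ (d + B).eval x.length := by
      have h := congrArg (Int.cast : ℤ → ℝ) (hgv x)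
      push_cast at h
      rw [h, Finset.sum_add_distrib]
      simp
    have h2 : ((2 : ℝ) ^ p.eval x.length * 2 ^ (d + B).eval x.length) / 2 ^ B.eval x.length =
        2 ^ c := by
      rw [Polynomial.eval_add, pow_add, ← mul_assoc, mul_div_assoc, div_self (by positivity),
        mul_one, ← pow_add]
      simp [c]
    have h3 : (g x : ℝ) / (2 ^ B.eval x.length : ℕ) - (r x + (2 ^ c : ℕ) : ℚ) =
        ∑ u : Fin (p.eval x.length) → Bool,
          ((v (x, List.ofFn u, B.eval x.length) : ℝ) / 2 ^ B.eval x.length -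
            w x (List.ofFn u)) := by
      push_cast
      rw [h1, add_div, h2, Finset.sum_sub_distrib, ← hf, hr, Finset.sum_div]
      ring
    rw [h3]
    refine (Finset.abs_sum_le_sum_abs _ _).trans ?_
    refine (Finset.sum_le_sum fun u _ => (abs_sub_comm _ _).trans_le (hw x _ _)).trans ?_
    simp [div_eq_mul_inv]
  obtain ⟨h1, h2⟩ := search_eq (X := 2 ^ p.eval x.length) (Q := 2 ^ q.eval x.length)
    (N := g x) (D := 2 ^ B.eval x.length) (by positivity) (by positivity)
    (le_of_eq (by rw [hB]; ring)) (hden' ▸ hden) happrox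
  rw [hden'] at h2
  rw [hnum'] at h1
  simp only [F, h2, encodeInt]
  generalize (search (2 ^ p.eval x.length) (2 ^ q.eval x.length) (g x) (2 ^ B.eval x.length)).1 = h
    at h1
  change (Nat.blt h (2 ^ c * (r x).den) ::
    ((h - 2 ^ c * (r x).den) + (2 ^ c * (r x).den - h)).bits, _) = _
  have h1' : (h : ℤ) = (r x).num + (2 ^ c * (r x).den : ℕ) := by rw [h1]; push_cast; rfl
  generalize 2 ^ c * (r x).den = m at h1'
  have e1 : Nat.blt h m = decide ((r x).num < 0) := by
    rw [Bool.eq_iff_iff, Nat.blt_eq, decide_eq_true_eq]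
    omega
  have e2 : (h - m) + (m - h) = (r x).num.natAbs := by omega
  rw [e1, e2]
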